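/- Let $\Gamma$ be a metrized graph, i.e. a finite connected graph with non-empty vertex set $V(\Gamma)$ (multiple edges and self-loops are allowed), each of whose edges $e$ is parametrized by a segment $[0,L_e]$ with $L_e>0$; $\Gamma$ is regarded as the topological space obtained by gluing these segments at the vertices, with its length measure $dx$. Let $\mathrm{Zh}(\Gamma)$ be the set of continuous functions $f:\Gamma\to\mathbb{R}$ such that, for some finite set $S\subset\Gamma$ containing the vertices, $f$ is $C^2$ on $\Gamma\setminus S$ and $f''\in L^1(\Gamma)$. For $f\in\mathrm{Zh}(\Gamma)$ let $$\Delta_x f(x) = -f''(x)\,dx-\sum_{p\in S}\Big[\sum_{\vec v\text{ at }p} d_{\vec v}f(p)\Big]\delta_p(x),$$ where $\delta_p$ is the Dirac measure at $p$ and $\vec v$ runs over the directions emanating from $p$; this signed measure does not depend on $S$. For $y,z\in\Gamma$ let the voltage function $x\mapsto j_z(x,y)$ be the unique $f\in\mathrm{Zh}(\Gamma)$ with $\Delta_x f=\delta_y-\delta_z$ and $f(z)=0$ (the voltage difference between $x$ and $z$ when unit current enters at $y$ and exits at $z$, edge lengths being resistances). The canonical measure $\mu_{\mathrm{can}}$ of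 $\Gamma$ is the unique finite real-valued signed Borel measure $\mu$ on $\Gamma$ with $\mu(\Gamma)=1$ such that $j_\mu(x,x)=\int_\Gamma j_\zeta(x,x)\,d\mu(\zeta)$ is constant in $x\in\Gamma$. **Theorem.** There is exactly one such measure $\mu_{\mathrm{can}}$, and for any $p,q\in\Gamma$ the function $x\mapsto j_x(p,q)$ belongs to $\mathrm{Zh}(\Gamma)$ and $$2\mu_{\mathrm{can}}(x)=\Delta_x\, j_x(p,q)+\delta_q(x)+\delta_p(x).$$ -/

import Mathlib

open MeasureTheory Set

/-- A metrized graph with vertex set `V` and edge set `E`: a connected graph with at least one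
vertex, each edge `e` being parametrized by the segment `[0, len e]` of positive length, starting
at the vertex `tail e` and ending at the vertex `head e`. Multiple edges and self-loops are allowed.
(Finiteness of `V` and `E` is expressed by instances where it is needed.) -/
structure MetrizedGraph (V E : Type*) where
  tail : E → V
  head : E → V
  len : E → ℝ
  len_pos : ∀ e, 0 < len e
  nonempty : Nonempty V
  connected : ∀ a b : V, Relation.EqvGen (fun v w => ∃ e, tail e = v ∧ head e = w) a b

namespace MetrizedGraph

/-- The points of the metrized graph, as a one-dimensional space: the vertices, and the points in
the interior of an edge. -/
inductive Point {V E : Type*} (Γ : MetrizedGraph V E) where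
  | vertex (v : V) : Point Γ
  | inner (e : E) (t : Ioo (0 : ℝ) (Γ.len e)) : Point Γ

instance {V E : Type*} (Γ : MetrizedGraph V E) : Nonempty Γ.Point :=
  Γ.nonempty.map Point.vertex

/-- The distinguished parametrization `[0, len e] → Γ` of the edge `e`, extended to all of `ℝ` so
as to be constant on `(-∞, 0]` and on `[len e, ∞)`. -/
noncomputable def param {V E : Type*} (Γ : MetrizedGraph V E) (e : E) (t : ℝ) : Γ.Point :=
  if h₀ : t ≤ 0 then Point.vertex (Γ.tail e)
  else if h₁ : Γ.len e ≤ t then Point.vertex (Γ.head e)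
  else Point.inner e ⟨t, not_le.mp h₀, not_le.mp h₁⟩

/-- The topology obtained by gluing the segments `[0, len e]` at their end points: a set is open if
and only if its preimage in each segment is open. -/
noncomputable instance {V E : Type*} (Γ : MetrizedGraph V E) : TopologicalSpace Γ.Point :=
  ⨆ e, TopologicalSpace.coinduced (fun t : Icc (0 : ℝ) (Γ.len e) => Γ.param e t) inferInstance

noncomputable instance {V E : Type*} (Γ : MetrizedGraph V E) : MeasurableSpace Γ.Point := borel Γ.Point

instance {V E : Type*} (Γ : MetrizedGraph V E) : BorelSpace Γ.Point := ⟨rfl⟩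

theorem param_projIcc {V E : Type*} (Γ : MetrizedGraph V E) (e : E) (t : ℝ) :
    Γ.param e (projIcc 0 (Γ.len e) (Γ.len_pos e).le t) = Γ.param e t := by
  have hL := Γ.len_pos e
  rcases le_or_gt t 0 with h | h
  · rw [projIcc_of_le_left _ h]
    simp [param, h]
  · rcases le_or_gt (Γ.len e) t with h' | h'
    · rw [projIcc_of_right_le _ h']
      simp [param, h', hL.not_ge, h.not_ge]
    · rw [projIcc_of_mem _ ⟨h.le, h'.le⟩]

theorem continuous_param {V E : Type*} (Γ : MetrizedGraph V E) (e : E) :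
    Continuous (Γ.param e) := by
  have h : Continuous (fun t : Icc (0 : ℝ) (Γ.len e) => Γ.param e t) := by
    rw [continuous_iff_coinduced_le]
    exact le_iSup (fun e => TopologicalSpace.coinduced
      (fun t : Icc (0 : ℝ) (Γ.len e) => Γ.param e t) inferInstance) e
  have h' := h.comp (continuous_projIcc (a := 0) (b := Γ.len e) (h := (Γ.len_pos e).le))
  exact h'.congr (fun t => Γ.param_projIcc e t)

/-- The length measure `dx` on `Γ`. -/
noncomputable def length {V E : Type*} [Fintype E] (Γ : MetrizedGraph V E) : Measure Γ.Point :=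
  ∑ e, Measure.map (Γ.param e) (volume.restrict (Ioo 0 (Γ.len e)))

/-- The second derivative `f''` with respect to arc length in the interior of the edges (set to
be `0` at the finitely many vertices). -/
noncomputable def secondDeriv {V E : Type*} (Γ : MetrizedGraph V E) (f : Γ.Point → ℝ) :
    Γ.Point → ℝ
  | .vertex _ => 0
  | .inner e t => deriv (deriv (fun s => f (Γ.param e s))) t

open Classical in
/-- The sum of the directional derivatives `d_v f(p)` of `f` at `p` over all the directions `v`
emanating from `p`. An edge starting (ending) at the vertex `p` contributes its initial direction
(its reversed final direction); a self-loop contributes both. A point in the interior of an edge has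
two directions. -/
noncomputable def slopeSum {V E : Type*} [Fintype E] (Γ : MetrizedGraph V E) (f : Γ.Point → ℝ) :
    Γ.Point → ℝ
  | .vertex v =>
      ∑ e, ((if Γ.tail e = v then derivWithin (fun s => f (Γ.param e s)) (Ici 0) 0 else 0) +
        (if Γ.head e = v then
          -derivWithin (fun s => f (Γ.param e s)) (Iic (Γ.len e)) (Γ.len e) else 0))
  | .inner e t =>
      derivWithin (fun s => f (Γ.param e s)) (Ici (t : ℝ)) t
        - derivWithin (fun s => f (Γ.param e s)) (Iic (t : ℝ)) t

theorem slopeSum_inner_of_differentiableAt {V E : Type*} [Fintype E] (Γ : MetrizedGraph V E)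
    (f : Γ.Point → ℝ) (e : E) (t : Ioo (0 : ℝ) (Γ.len e))
    (h : DifferentiableAt ℝ (fun s => f (Γ.param e s)) t) :
    Γ.slopeSum f (.inner e t) = 0 := by
  simp only [slopeSum]
  rw [h.derivWithin (uniqueDiffOn_Ici _ _ self_mem_Ici),
    h.derivWithin (uniqueDiffOn_Iic _ _ self_mem_Iic), sub_self]

/-- `f` belongs to `Zh(Γ)` (real-valued functions): it is continuous and, for some finite set `S`
of points containing the vertices, it is `C²` on `Γ \ S` and `f''` is integrable on `Γ`. -/
def MemZh {V E : Type*} [Fintype E] (Γ : MetrizedGraph V E) (f : Γ.Point → ℝ) : Prop :=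
  Continuous f ∧
    (∃ S : Set Γ.Point, S.Finite ∧ range Point.vertex ⊆ S ∧
      ∀ e, ContDiffOn ℝ 2 (fun s => f (Γ.param e s))
        {t | t ∈ Ioo 0 (Γ.len e) ∧ Γ.param e t ∉ S}) ∧
    Integrable (Γ.secondDeriv f) Γ.length

/-- The measure valued Laplacian `Δ f = -f''(x) dx - ∑ₚ (∑_v d_v f(p)) δₚ` of `f ∈ Zh(Γ)`. The sum
of directional derivatives vanishes at every interior point of an edge at which `f` is
differentiable, so the sum over all points `p` is finite, and equals the sum over any
sufficiently fine vertex set. -/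
noncomputable def laplacian {V E : Type*} [Fintype E] (Γ : MetrizedGraph V E)
    (f : Γ.Point → ℝ) : SignedMeasure Γ.Point :=
  -(Γ.length.withDensityᵥ (Γ.secondDeriv f))
    - ∑ᶠ p : Γ.Point, Γ.slopeSum f p • VectorMeasure.dirac p (1 : ℝ)

/-- The Dirac measure `δₚ`. -/
noncomputable def dirac {V E : Type*} (Γ : MetrizedGraph V E) (p : Γ.Point) :
    SignedMeasure Γ.Point :=
  VectorMeasure.dirac p (1 : ℝ)

/-- `f` is the electric potential on `Γ` (with resistances given by lengths), normalized to be `0`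
at `z`, when unit current enters at `y` and exits at `z`. -/
def IsPotential {V E : Type*} [Fintype E] (Γ : MetrizedGraph V E) (z y : Γ.Point)
    (f : Γ.Point → ℝ) : Prop :=
  Γ.MemZh f ∧ Γ.laplacian f = Γ.dirac y - Γ.dirac z ∧ f z = 0

/-- The voltage function `j_z(x, y)`: the value at `x` of the (unique) potential normalized to be
`0` at `z`, when unit current enters at `y` and exits at `z`. -/
noncomputable def voltage {V E : Type*} [Fintype E] (Γ : MetrizedGraph V E)
    (z x y : Γ.Point) : ℝ :=
  Classical.epsilon (Γ.IsPotential z y) x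

/-- `j_μ(x, y) = ∫ j_ζ(x, y) dμ(ζ)` for a real-valued signed Borel measure `μ`. -/
noncomputable def voltageIntegral {V E : Type*} [Fintype E] (Γ : MetrizedGraph V E)
    (μ : SignedMeasure Γ.Point) (x y : Γ.Point) : ℝ :=
  VectorMeasure.integral μ (fun ζ => Γ.voltage ζ x y) (ContinuousLinearMap.lsmul ℝ ℝ).flip

/-- The property defining the canonical measure: `μ` is a real-valued signed Borel measure of total
mass `1` such that `j_μ(x, x)` is constant on `Γ`. -/
def IsCanonical {V E : Type*} [Fintype E] (Γ : MetrizedGraph V E)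
    (μ : SignedMeasure Γ.Point) : Prop :=
  μ univ = 1 ∧ ∃ c : ℝ, ∀ x, Γ.voltageIntegral μ x x = c

/-- The canonical measure of `Γ`: the (unique) measure with the defining property. -/
noncomputable def canonicalMeasure {V E : Type*} [Fintype E] (Γ : MetrizedGraph V E) :
    SignedMeasure Γ.Point :=
  Classical.epsilon Γ.IsCanonical

end MetrizedGraph

open Filter Topology

namespace MetrizedGraph

/-! ### Topology of the graph and its length measure. -/

section Topology

variable {V E : Type*} (Γ : MetrizedGraph V E)

/-! The proof rests on an explicit symmetric Green function `green`, written g below, with Δ_x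
g(x,y) = δ_y - u, where u is the uniform probability measure on the vertices (`laplacian_green`). It
is the sum of the Dirichlet Green functions of the edges and of the bilinear interpolation of a
matrix M = (Q + J)⁻¹, where Q is the combinatorial Laplacian with conductances 1/L_e and J is the
all-ones matrix.

A function with zero Laplacian is affine on edges and obeys Kirchhoff's law, so its energy vanishes
and it is constant (`MemZh.eq_of_laplacian_eq_zero`). Hence potentials are unique and j_z(x,y) =
g(x,y) - g(x,z) - g(z,y) + g(z,z) (`voltage_eq`). As a function of x, j_x(p,q) is therefore g(x,x) -
g(x,p) - g(x,q) + g(p,q), with Laplacian Δg(x,x) + 2u - δ_p - δ_q. The required formula thus holds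
for μ = ½ Δg(x,x) + u (`greenMeasure`), and it remains to see that μ is the only canonical measure.

Existence: j_μ(x,x) = g(x,x) - 2∫g(x,·)dμ + const. The diagonal g(x,x) is quadratic on every edge,
and Green's identity gives ∫g(x,·)dΔf = f(x) - mean of f over the vertices for such f
(`IsQuadratic.integral_green_laplacian`). Since ∫g(x,·)du is constant, the terms g(x,x) cancel.

Uniqueness: the difference σ of two canonical measures has mass 0 and ∫g(x,·)dσ is constant.
Combinations of g give ∫ tent dσ = 0 for every tent function on an edge; differentiating in the
position of the apex shows that σ vanishes on edge interiors (`apply_coord_gt_eq`,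
`apply_coord_preimage_eq_zero`). What remains lives on the vertices and is killed by linear algebra
(`eq_zero_of_integral_green_eq`). -/

theorem param_of_mem {e : E} {t : ℝ} (ht : t ∈ Ioo 0 (Γ.len e)) :
    Γ.param e t = .inner e ⟨t, ht⟩ := by
  simp [param, ht.1.not_ge, ht.2.not_ge]

theorem param_zero (e : E) : Γ.param e 0 = .vertex (Γ.tail e) := by simp [param]

theorem param_len (e : E) : Γ.param e (Γ.len e) = .vertex (Γ.head e) := by
  simp [param, (Γ.len_pos e).not_ge]

theorem param_coe {e : E} (t : Ioo (0 : ℝ) (Γ.len e)) : Γ.param e t = .inner e t :=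
  Γ.param_of_mem t.2

theorem continuous_iff_continuousOn_param {Y : Type*} [TopologicalSpace Y] {f : Γ.Point → Y} :
    Continuous f ↔ ∀ e, ContinuousOn (fun t => f (Γ.param e t)) (Icc 0 (Γ.len e)) := by
  refine ⟨fun h e => (h.comp (Γ.continuous_param e)).continuousOn, fun h => ?_⟩
  refine continuous_iSup_dom.2 fun e => continuous_coinduced_dom.2 ?_
  exact continuousOn_iff_continuous_domRestrict.1 (h e)

theorem isClosed_iff_param {s : Set Γ.Point} :
    IsClosed s ↔ ∀ e, IsClosed ((fun t : Icc (0 : ℝ) (Γ.len e) => Γ.param e t) ⁻¹' s) := by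
  rw [isClosed_iSup_iff]
  simp only [isClosed_coinduced]

theorem isOpen_iff_param {s : Set Γ.Point} :
    IsOpen s ↔ ∀ e, IsOpen ((fun t : Icc (0 : ℝ) (Γ.len e) => Γ.param e t) ⁻¹' s) := by
  rw [isOpen_iSup_iff]
  simp only [isOpen_coinduced]

theorem param_preimage_singleton_subset (e : E) (p : Γ.Point) :
    ∃ s, Ioo 0 (Γ.len e) ∩ Γ.param e ⁻¹' {p} ⊆ {s} := by
  cases p with
  | vertex v =>
    -- The intersection is empty here, so 0 is a dummy value.
    refine ⟨0, fun t ht => ?_⟩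
    have := ht.2
    simp [Γ.param_of_mem ht.1] at this
  | inner e' s =>
    refine ⟨s, fun t ht => ?_⟩
    have := ht.2
    rw [mem_preimage, Γ.param_of_mem ht.1, mem_singleton_iff] at this
    injection this with h1 h2
    subst h1
    rw [mem_singleton_iff, ← eq_of_heq h2]

theorem finite_param_preimage (e : E) {S : Set Γ.Point} (hS : S.Finite) :
    (Ioo 0 (Γ.len e) ∩ Γ.param e ⁻¹' S).Finite := by
  rw [← biUnion_of_singleton S, preimage_iUnion₂, inter_iUnion₂]
  refine hS.biUnion fun p _ => ?_
  obtain ⟨s, hs⟩ := Γ.param_preimage_singleton_subset e p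
  exact (finite_singleton s).subset hs

instance : T1Space Γ.Point where
  t1 p := by
    refine Γ.isClosed_iff_param.2 fun e => ?_
    have h : (Icc 0 (Γ.len e) ∩ Γ.param e ⁻¹' {p}).Finite := by
      refine ((Γ.finite_param_preimage e (finite_singleton p)).union
        (toFinite {0, Γ.len e})).subset fun t ht => ?_
      rcases eq_or_lt_of_le ht.1.1 with h | h
      · right; simp [← h]
      rcases eq_or_lt_of_le ht.1.2 with h' | h'
      · right; simp [h']
      · exact Or.inl ⟨⟨h, h'⟩, ht.2⟩
    convert (Set.Finite.preimage Subtype.val_injective.injOn h).isClosed using 1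
    ext t
    simp

instance [Finite V] [Finite E] : CompactSpace Γ.Point where
  isCompact_univ := by
    -- The vertices are listed separately because a one-point graph may have no edge to cover its
    -- vertex.
    have h : (univ : Set Γ.Point) =
        range Point.vertex ∪ ⋃ e, Γ.param e '' Icc 0 (Γ.len e) := by
      refine (eq_univ_of_forall fun p => ?_).symm
      cases p with
      | vertex v => exact Or.inl ⟨v, rfl⟩
      | inner e t =>
        exact Or.inr (mem_iUnion.2 ⟨e, t, ⟨t.2.1.le, t.2.2.le⟩, Γ.param_coe t⟩)
    rw [h]
    exact (finite_range _).isCompact.union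
      (isCompact_iUnion fun e => isCompact_Icc.image (Γ.continuous_param e))

/-- The length measure of a single edge. -/
noncomputable def edgeLength (e : E) : Measure Γ.Point :=
  Measure.map (Γ.param e) (volume.restrict (Ioo 0 (Γ.len e)))

theorem length_eq_sum_edgeLength [Fintype E] : Γ.length = ∑ e, Γ.edgeLength e := rfl

theorem measurable_param (e : E) : Measurable (Γ.param e) := (Γ.continuous_param e).measurable

instance (e : E) : IsFiniteMeasure (Γ.edgeLength e) := by
  unfold edgeLength
  infer_instance

instance (e : E) : NullSingletonClass (Γ.edgeLength e) where
  measure_singleton p := by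
    rw [edgeLength, Measure.map_apply (Γ.measurable_param e) (measurableSet_singleton p),
      Measure.restrict_apply ((Γ.measurable_param e) (measurableSet_singleton p)), inter_comm]
    obtain ⟨s, hs⟩ := Γ.param_preimage_singleton_subset e p
    exact measure_mono_null hs (by simp)

instance [Fintype E] : IsFiniteMeasure Γ.length := by
  rw [length_eq_sum_edgeLength]
  infer_instance

theorem length_eq_zero_of_finite [Fintype E] {S : Set Γ.Point} (hS : S.Finite) :
    Γ.length S = 0 := by
  rw [length_eq_sum_edgeLength, Measure.finsetSum_apply]
  exact Finset.sum_eq_zero fun e _ => hS.measure_zero _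

theorem ae_length_iff [Fintype E] {P : Γ.Point → Prop} :
    (∀ᵐ x ∂Γ.length, P x) ↔ ∀ e, ∀ᵐ x ∂Γ.edgeLength e, P x := by
  simp [ae_iff, length_eq_sum_edgeLength, Measure.finsetSum_apply]

theorem integrable_length_iff [Fintype E] {f : Γ.Point → ℝ} :
    Integrable f Γ.length ↔ ∀ e, Integrable f (Γ.edgeLength e) := by
  rw [length_eq_sum_edgeLength, integrable_finsetSum_measure]
  simp

theorem integral_edgeLength (e : E) {f : Γ.Point → ℝ} (hf : Continuous f) :
    ∫ x, f x ∂Γ.edgeLength e = ∫ t in (0 : ℝ)..Γ.len e, f (Γ.param e t) := by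
  rw [edgeLength, integral_map (Γ.measurable_param e).aemeasurable hf.measurable.aestronglyMeasurable,
    intervalIntegral.integral_of_le (Γ.len_pos e).le, integral_Ioc_eq_integral_Ioo]

theorem integrableOn_deriv_deriv [Fintype E] {f : Γ.Point → ℝ}
    (hf : Integrable (Γ.secondDeriv f) Γ.length) (e : E) :
    IntegrableOn (deriv (deriv fun s => f (Γ.param e s))) (Ioo 0 (Γ.len e)) := by
  have h := Γ.integrable_length_iff.1 hf e
  have h' := h.comp_measurable (Γ.measurable_param e)
  refine h'.congr ?_
  filter_upwards [self_mem_ae_restrict measurableSet_Ioo] with t ht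
  simp [Γ.param_of_mem ht, secondDeriv]

/-- The preimage under the parametrization of any other edge is empty. This makes edge interiors and
`coord` measurable. -/
theorem isOpen_param_image (e : E) (U : Set ℝ) (hU : IsOpen U) :
    IsOpen (Γ.param e '' (Ioo 0 (Γ.len e) ∩ U)) := by
  classical
  refine Γ.isOpen_iff_param.2 fun e' => ?_
  have : (fun t : Icc (0 : ℝ) (Γ.len e') => Γ.param e' t) ⁻¹' (Γ.param e '' (Ioo 0 (Γ.len e) ∩ U))
      = if e' = e then Subtype.val ⁻¹' (Ioo 0 (Γ.len e) ∩ U) else ∅ := by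
    ext ⟨t, h0, hL⟩
    simp only [mem_preimage, mem_image]
    constructor
    · rintro ⟨s, hs, h⟩
      rw [Γ.param_of_mem hs.1] at h
      rcases eq_or_lt_of_le h0 with rfl | h0
      · simp [param_zero] at h
      rcases eq_or_lt_of_le hL with rfl | hL
      · simp [param_len] at h
      rw [Γ.param_of_mem ⟨h0, hL⟩] at h
      cases h
      simpa using hs
    · split_ifs with h
      · subst h
        intro h
        exact ⟨t, h, rfl⟩
      · simp
  rw [this]
  split_ifs
  · exact (isOpen_Ioo.inter hU).preimage continuous_subtype_val
  · exact isOpen_empty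

theorem measurableSet_range_inner (e : E) :
    MeasurableSet (range (Point.inner e : _ → Γ.Point)) := by
  have h := (Γ.isOpen_param_image e univ isOpen_univ).measurableSet
  convert h
  ext p
  simp only [mem_range, Subtype.exists, inter_univ, mem_image]
  refine exists_congr fun t => ⟨fun ⟨h, h'⟩ => ⟨h, by rw [Γ.param_of_mem h, h']⟩,
    fun ⟨h, h'⟩ => ⟨h, by rw [← h', Γ.param_of_mem h]⟩⟩

theorem ae_edgeLength_mem (e : E) : ∀ᵐ x ∂Γ.edgeLength e, x ∈ range (Point.inner e) := by
  refine (ae_map_iff (p := (· ∈ range (Point.inner e))) (Γ.measurable_param e).aemeasurable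
    (Γ.measurableSet_range_inner e)).2 ?_
  filter_upwards [self_mem_ae_restrict measurableSet_Ioo] with t ht
  exact ⟨⟨t, ht⟩, (Γ.param_of_mem ht).symm⟩

instance (μ : SignedMeasure Γ.Point) : IsFiniteMeasure μ.variation := by
  rw [← SignedMeasure.totalVariation_eq_variation]
  infer_instance

theorem integrable_of_continuous [Finite V] [Finite E] (μ : SignedMeasure Γ.Point)
    {f : Γ.Point → ℝ} (hf : Continuous f) : VectorMeasure.Integrable μ f := by
  exact hf.integrable_of_hasCompactSupport (HasCompactSupport.of_compactSpace f)

end Topology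
end MetrizedGraph

/-! ### One-sided derivatives at exceptional points. -/

/-- Near `a`, the derivative of `u` is a primitive of an integrable function, hence has a limit at
`a`; together with continuity of `u` this limit is the right derivative. -/
theorem exists_hasDerivWithinAt_Ici_of_integrableOn {u : ℝ → ℝ} {a b : ℝ} (hab : a < b)
    (hc : ContinuousAt u a) (hu : ContDiffOn ℝ 2 u (Ioo a b))
    (hi : IntegrableOn (deriv (deriv u)) (Ioo a b)) :
    ∃ c, Tendsto (deriv u) (𝓝[>] a) (𝓝 c) ∧ HasDerivWithinAt u c (Ici a) a := by
  obtain ⟨m, ham, hmb⟩ := exists_between hab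
  have hv : ContDiffOn ℝ 1 (deriv u) (Ioo a b) :=
    hu.deriv_of_isOpen isOpen_Ioo (by norm_num)
  have hi' : IntegrableOn (deriv (deriv u)) (uIcc a m) := by
    rw [uIcc_of_le ham.le, integrableOn_Icc_iff_integrableOn_Ioo]
    exact hi.mono_set (Ioo_subset_Ioo_right hmb.le)
  have hlim : Tendsto (fun s => deriv u m - ∫ x in s..m, deriv (deriv u) x) (𝓝[>] a)
      (𝓝 (deriv u m - ∫ x in a..m, deriv (deriv u) x)) := by
    refine tendsto_const_nhds.sub ?_
    have := intervalIntegral.continuousOn_primitive_interval_left hi' a left_mem_uIcc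
    refine this.tendsto.mono_left ?_
    rw [uIcc_of_le ham.le]
    exact nhdsWithin_le_of_mem (Icc_mem_nhdsGT_of_mem ⟨le_rfl, ham⟩)
  have heq : (fun s => deriv u m - ∫ x in s..m, deriv (deriv u) x) =ᶠ[𝓝[>] a] deriv u := by
    filter_upwards [Ioo_mem_nhdsGT ham] with s hs
    have hsub : uIcc s m ⊆ Ioo a b := by
      rw [uIcc_of_le hs.2.le]
      exact fun x hx => ⟨hs.1.trans_le hx.1, hx.2.trans_lt hmb⟩
    rw [intervalIntegral.integral_eq_sub_of_hasDerivAt (f := deriv u)]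
    · ring
    · intro x hx
      exact ((hv.contDiffAt (isOpen_Ioo.mem_nhds (hsub hx))).differentiableAt
        (by norm_num)).hasDerivAt
    · refine (intervalIntegrable_iff_integrableOn_Icc_of_le hs.2.le).2 ?_
      rw [← uIcc_of_le hs.2.le]
      exact hi.mono_set hsub
  have hlim' := hlim.congr' heq
  exact ⟨_, hlim', hasDerivWithinAt_Ici_of_tendsto_deriv
    (hu.differentiableOn (by norm_num)) hc.continuousWithinAt (Ioo_mem_nhdsGT hab) hlim'⟩

theorem exists_hasDerivWithinAt_Iic_of_integrableOn {u : ℝ → ℝ} {a b : ℝ} (hab : a < b)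
    (hc : ContinuousAt u b) (hu : ContDiffOn ℝ 2 u (Ioo a b))
    (hi : IntegrableOn (deriv (deriv u)) (Ioo a b)) :
    ∃ c, Tendsto (deriv u) (𝓝[<] b) (𝓝 c) ∧ HasDerivWithinAt u c (Iic b) b := by
  obtain ⟨m, ham, hmb⟩ := exists_between hab
  have hv : ContDiffOn ℝ 1 (deriv u) (Ioo a b) :=
    hu.deriv_of_isOpen isOpen_Ioo (by norm_num)
  have hi' : IntegrableOn (deriv (deriv u)) (uIcc m b) := by
    rw [uIcc_of_le hmb.le, integrableOn_Icc_iff_integrableOn_Ioo]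
    exact hi.mono_set (Ioo_subset_Ioo_left ham.le)
  have hlim : Tendsto (fun s => deriv u m + ∫ x in m..s, deriv (deriv u) x) (𝓝[<] b)
      (𝓝 (deriv u m + ∫ x in m..b, deriv (deriv u) x)) := by
    refine tendsto_const_nhds.add ?_
    have := intervalIntegral.continuousOn_primitive_interval hi' b right_mem_uIcc
    refine this.tendsto.mono_left ?_
    rw [uIcc_of_le hmb.le]
    exact nhdsWithin_le_of_mem (Icc_mem_nhdsLT_of_mem ⟨hmb, le_rfl⟩)
  have heq : (fun s => deriv u m + ∫ x in m..s, deriv (deriv u) x) =ᶠ[𝓝[<] b] deriv u := by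
    filter_upwards [Ioo_mem_nhdsLT hmb] with s hs
    have hsub : uIcc m s ⊆ Ioo a b := by
      rw [uIcc_of_le hs.1.le]
      exact fun x hx => ⟨ham.trans_le hx.1, hx.2.trans_lt hs.2⟩
    rw [intervalIntegral.integral_eq_sub_of_hasDerivAt (f := deriv u)]
    · ring
    · intro x hx
      exact ((hv.contDiffAt (isOpen_Ioo.mem_nhds (hsub hx))).differentiableAt
        (by norm_num)).hasDerivAt
    · refine (intervalIntegrable_iff_integrableOn_Icc_of_le hs.1.le).2 ?_
      rw [← uIcc_of_le hs.1.le]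
      exact hi.mono_set hsub
  have hlim' := hlim.congr' heq
  exact ⟨_, hlim', hasDerivWithinAt_Iic_of_tendsto_deriv
    (hu.differentiableOn (by norm_num)) hc.continuousWithinAt (Ioo_mem_nhdsLT hab) hlim'⟩

namespace MetrizedGraph

/-! ### Linearity of the Laplacian on Zh(Γ). -/

section MemZh

variable {V E : Type*} (Γ : MetrizedGraph V E)

theorem isOpen_param_notMem (e : E) {S : Set Γ.Point} (hS : S.Finite) :
    IsOpen {t | t ∈ Ioo 0 (Γ.len e) ∧ Γ.param e t ∉ S} :=
  isOpen_Ioo.inter (hS.isClosed.isOpen_compl.preimage (Γ.continuous_param e))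

theorem param_notMem_mem_nhdsNE (e : E) {S : Set Γ.Point} (hS : S.Finite) (t : ℝ) :
    {s | s ∈ Ioo 0 (Γ.len e) → Γ.param e s ∉ S} ∈ 𝓝[≠] t := by
  have h : ((Ioo 0 (Γ.len e) ∩ Γ.param e ⁻¹' S) \ {t})ᶜ ∈ 𝓝 t :=
    ((Γ.finite_param_preimage e hS).subset sdiff_subset).isClosed.isOpen_compl.mem_nhds (by simp)
  filter_upwards [mem_nhdsWithin_of_mem_nhds h, self_mem_nhdsWithin] with s hs hst hs' hs''
  exact hs ⟨⟨hs', hs''⟩, hst⟩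

theorem exists_Ioo_right_subset (e : E) {S : Set Γ.Point} (hS : S.Finite) {t : ℝ}
    (ht : t ∈ Ico 0 (Γ.len e)) :
    ∃ b > t, Ioo t b ⊆ {s | s ∈ Ioo 0 (Γ.len e) ∧ Γ.param e s ∉ S} := by
  refine (mem_nhdsGT_iff_exists_Ioo_subset).1 ?_
  filter_upwards [nhdsGT_le_nhdsNE t (Γ.param_notMem_mem_nhdsNE e hS t),
    Ioo_mem_nhdsGT ht.2] with s hs hs'
  have : s ∈ Ioo 0 (Γ.len e) := ⟨ht.1.trans_lt hs'.1, hs'.2⟩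
  exact ⟨this, hs this⟩

theorem exists_Ioo_left_subset (e : E) {S : Set Γ.Point} (hS : S.Finite) {t : ℝ}
    (ht : t ∈ Ioc 0 (Γ.len e)) :
    ∃ a < t, Ioo a t ⊆ {s | s ∈ Ioo 0 (Γ.len e) ∧ Γ.param e s ∉ S} := by
  refine (mem_nhdsLT_iff_exists_Ioo_subset).1 ?_
  filter_upwards [nhdsLT_le_nhdsNE t (Γ.param_notMem_mem_nhdsNE e hS t),
    Ioo_mem_nhdsLT ht.1] with s hs hs'
  have : s ∈ Ioo 0 (Γ.len e) := ⟨hs'.1, hs'.2.trans_le ht.2⟩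
  exact ⟨this, hs this⟩

variable {Γ} [Fintype E] {f g : Γ.Point → ℝ}

/-- Directional derivatives exist even at the exceptional points, so the `derivWithin` terms of
`slopeSum` are genuine and therefore additive. -/
theorem MemZh.exists_hasDerivWithinAt_Ici (hf : Γ.MemZh f) (e : E) {t : ℝ}
    (ht : t ∈ Ico 0 (Γ.len e)) :
    ∃ c, Tendsto (deriv fun s => f (Γ.param e s)) (𝓝[>] t) (𝓝 c) ∧
      HasDerivWithinAt (fun s => f (Γ.param e s)) c (Ici t) t := by
  obtain ⟨hc, ⟨S, hS, -, hd⟩, hi⟩ := hf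
  obtain ⟨b, hb, hsub⟩ := Γ.exists_Ioo_right_subset e hS ht
  exact exists_hasDerivWithinAt_Ici_of_integrableOn hb (hc.comp (Γ.continuous_param e)).continuousAt
    ((hd e).mono hsub) ((Γ.integrableOn_deriv_deriv hi e).mono_set fun s hs => (hsub hs).1)

theorem MemZh.exists_hasDerivWithinAt_Iic (hf : Γ.MemZh f) (e : E) {t : ℝ}
    (ht : t ∈ Ioc 0 (Γ.len e)) :
    ∃ c, Tendsto (deriv fun s => f (Γ.param e s)) (𝓝[<] t) (𝓝 c) ∧
      HasDerivWithinAt (fun s => f (Γ.param e s)) c (Iic t) t := by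
  obtain ⟨hc, ⟨S, hS, -, hd⟩, hi⟩ := hf
  obtain ⟨a, ha, hsub⟩ := Γ.exists_Ioo_left_subset e hS ht
  exact exists_hasDerivWithinAt_Iic_of_integrableOn ha (hc.comp (Γ.continuous_param e)).continuousAt
    ((hd e).mono hsub) ((Γ.integrableOn_deriv_deriv hi e).mono_set fun s hs => (hsub hs).1)

theorem MemZh.differentiableWithinAt_Ici (hf : Γ.MemZh f) (e : E) {t : ℝ}
    (ht : t ∈ Ico 0 (Γ.len e)) :
    DifferentiableWithinAt ℝ (fun s => f (Γ.param e s)) (Ici t) t :=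
  let ⟨_, _, h⟩ := hf.exists_hasDerivWithinAt_Ici e ht
  h.differentiableWithinAt

theorem MemZh.differentiableWithinAt_Iic (hf : Γ.MemZh f) (e : E) {t : ℝ}
    (ht : t ∈ Ioc 0 (Γ.len e)) :
    DifferentiableWithinAt ℝ (fun s => f (Γ.param e s)) (Iic t) t :=
  let ⟨_, _, h⟩ := hf.exists_hasDerivWithinAt_Iic e ht
  h.differentiableWithinAt

theorem slopeSum_add (hf : Γ.MemZh f) (hg : Γ.MemZh g) (p : Γ.Point) :
    Γ.slopeSum (f + g) p = Γ.slopeSum f p + Γ.slopeSum g p := by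
  have h1 (e : E) {t : ℝ} (ht : t ∈ Ico 0 (Γ.len e)) :
      derivWithin (fun s => (f + g) (Γ.param e s)) (Ici t) t =
        derivWithin (fun s => f (Γ.param e s)) (Ici t) t +
          derivWithin (fun s => g (Γ.param e s)) (Ici t) t :=
    derivWithin_add (hf.differentiableWithinAt_Ici e ht) (hg.differentiableWithinAt_Ici e ht)
  have h2 (e : E) {t : ℝ} (ht : t ∈ Ioc 0 (Γ.len e)) :
      derivWithin (fun s => (f + g) (Γ.param e s)) (Iic t) t =
        derivWithin (fun s => f (Γ.param e s)) (Iic t) t +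
          derivWithin (fun s => g (Γ.param e s)) (Iic t) t :=
    derivWithin_add (hf.differentiableWithinAt_Iic e ht) (hg.differentiableWithinAt_Iic e ht)
  cases p with
  | vertex v =>
    simp only [slopeSum, ← Finset.sum_add_distrib]
    refine Finset.sum_congr rfl fun e _ => ?_
    rw [h1 e ⟨le_rfl, Γ.len_pos e⟩, h2 e ⟨Γ.len_pos e, le_rfl⟩]
    split_ifs <;> ring
  | inner e t =>
    simp only [slopeSum]
    rw [h1 e ⟨t.2.1.le, t.2.2⟩, h2 e ⟨t.2.1, t.2.2.le⟩]
    ring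

theorem slopeSum_const_smul (c : ℝ) (f : Γ.Point → ℝ) (p : Γ.Point) :
    Γ.slopeSum (c • f) p = c * Γ.slopeSum f p := by
  have h1 (e : E) (s : Set ℝ) (t : ℝ) : derivWithin (fun s => (c • f) (Γ.param e s)) s t =
      c * derivWithin (fun s => f (Γ.param e s)) s t :=
    derivWithin_const_mul_field c
  cases p with
  | vertex v =>
    simp only [slopeSum, Finset.mul_sum, h1]
    refine Finset.sum_congr rfl fun e _ => ?_
    split_ifs <;> ring
  | inner e t =>
    simp only [slopeSum, h1]
    ring

omit [Fintype E] in
theorem secondDeriv_const_smul (c : ℝ) (f : Γ.Point → ℝ) :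
    Γ.secondDeriv (c • f) = c • Γ.secondDeriv f := by
  funext p
  cases p with
  | vertex v => simp [secondDeriv]
  | inner e t =>
    simp only [secondDeriv, Pi.smul_apply, smul_eq_mul]
    have : deriv (fun s => c * f (Γ.param e s)) = fun s => c * deriv (fun s => f (Γ.param e s)) s := by
      funext s
      exact deriv_const_mul_field c
    rw [this]
    exact deriv_const_mul_field c

theorem deriv_deriv_add_of_contDiffOn {u v : ℝ → ℝ} {U : Set ℝ} (hU : IsOpen U)
    (hu : ContDiffOn ℝ 2 u U) (hv : ContDiffOn ℝ 2 v U) {t : ℝ} (ht : t ∈ U) :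
    deriv (deriv fun s => u s + v s) t = deriv (deriv u) t + deriv (deriv v) t := by
  have h : deriv (fun s => u s + v s) =ᶠ[𝓝 t] fun s => deriv u s + deriv v s := by
    filter_upwards [hU.mem_nhds ht] with s hs
    exact deriv_add ((hu.differentiableOn (by norm_num)).differentiableAt (hU.mem_nhds hs))
      ((hv.differentiableOn (by norm_num)).differentiableAt (hU.mem_nhds hs))
  rw [h.deriv_eq]
  have h1 : ContDiffOn ℝ 1 (deriv u) U := hu.deriv_of_isOpen hU (by norm_num)
  have h2 : ContDiffOn ℝ 1 (deriv v) U := hv.deriv_of_isOpen hU (by norm_num)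
  exact deriv_add ((h1.differentiableOn (by norm_num)).differentiableAt (hU.mem_nhds ht))
    ((h2.differentiableOn (by norm_num)).differentiableAt (hU.mem_nhds ht))

/-- Equality is only almost everywhere: at exceptional points `deriv` may take its default value 0.
-/
theorem secondDeriv_add_ae (hf : Γ.MemZh f) (hg : Γ.MemZh g) :
    Γ.secondDeriv (f + g) =ᵐ[Γ.length] Γ.secondDeriv f + Γ.secondDeriv g := by
  obtain ⟨-, ⟨S, hS, hVS, hdf⟩, -⟩ := hf
  obtain ⟨-, ⟨T, hT, hVT, hdg⟩, -⟩ := hg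
  have h0 : ∀ᵐ p ∂Γ.length, p ∉ S ∪ T :=
    measure_eq_zero_iff_ae_notMem.1 (Γ.length_eq_zero_of_finite (hS.union hT))
  filter_upwards [h0] with p hp
  cases p with
  | vertex v => simp [secondDeriv]
  | inner e t =>
    refine deriv_deriv_add_of_contDiffOn (Γ.isOpen_param_notMem e (hS.union hT))
      ((hdf e).mono fun s hs => ⟨hs.1, fun h => hs.2 (Or.inl h)⟩)
      ((hdg e).mono fun s hs => ⟨hs.1, fun h => hs.2 (Or.inr h)⟩) ⟨t.2, ?_⟩
    rwa [Γ.param_coe]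

theorem MemZh.add (hf : Γ.MemZh f) (hg : Γ.MemZh g) : Γ.MemZh (f + g) := by
  refine ⟨hf.1.add hg.1, ?_, (hf.2.2.add hg.2.2).congr (secondDeriv_add_ae hf hg).symm⟩
  obtain ⟨-, ⟨S, hS, hVS, hdf⟩, -⟩ := hf
  obtain ⟨-, ⟨T, hT, hVT, hdg⟩, -⟩ := hg
  refine ⟨S ∪ T, hS.union hT, hVS.trans subset_union_left, fun e => ?_⟩
  exact ((hdf e).mono fun s hs => ⟨hs.1, fun h => hs.2 (Or.inl h)⟩).add
    ((hdg e).mono fun s hs => ⟨hs.1, fun h => hs.2 (Or.inr h)⟩)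

theorem MemZh.const_smul (c : ℝ) (hf : Γ.MemZh f) : Γ.MemZh (c • f) := by
  refine ⟨hf.1.const_smul c, ?_, ?_⟩
  · obtain ⟨-, ⟨S, hS, hVS, hdf⟩, -⟩ := hf
    exact ⟨S, hS, hVS, fun e => (hdf e).const_smul c⟩
  · rw [secondDeriv_const_smul]
    exact hf.2.2.smul c

omit [Fintype E] in
theorem MemZh.differentiableAt_of_notMem (e : E) {S : Set Γ.Point} (hS : S.Finite)
    (hd : ContDiffOn ℝ 2 (fun s => f (Γ.param e s)) {t | t ∈ Ioo 0 (Γ.len e) ∧ Γ.param e t ∉ S})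
    {t : ℝ} (ht : t ∈ Ioo 0 (Γ.len e)) (htS : Γ.param e t ∉ S) :
    DifferentiableAt ℝ (fun s => f (Γ.param e s)) t :=
  (hd.differentiableOn (by norm_num)).differentiableAt
    ((Γ.isOpen_param_notMem e hS).mem_nhds ⟨ht, htS⟩)

theorem MemZh.finite_support_slopeSum (hf : Γ.MemZh f) :
    (Function.support (Γ.slopeSum f)).Finite := by
  obtain ⟨-, ⟨S, hS, hVS, hd⟩, -⟩ := hf
  refine hS.subset fun p hp => ?_
  by_contra hpS
  cases p with
  | vertex v => exact hpS (hVS ⟨v, rfl⟩)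
  | inner e t =>
    exact hp (Γ.slopeSum_inner_of_differentiableAt f e t
      (MemZh.differentiableAt_of_notMem e hS (hd e) t.2 (by rwa [Γ.param_coe])))

theorem MemZh.finite_support_slopeSum_smul (hf : Γ.MemZh f) :
    (Function.support fun p => Γ.slopeSum f p • VectorMeasure.dirac p (1 : ℝ)).Finite :=
  hf.finite_support_slopeSum.subset fun p hp (h : _ = 0) => hp (by simp [h])

theorem laplacian_add (hf : Γ.MemZh f) (hg : Γ.MemZh g) :
    Γ.laplacian (f + g) = Γ.laplacian f + Γ.laplacian g := by
  have h : ∀ p, Γ.slopeSum (f + g) p • VectorMeasure.dirac p (1 : ℝ) =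
      Γ.slopeSum f p • VectorMeasure.dirac p (1 : ℝ) +
        Γ.slopeSum g p • VectorMeasure.dirac p (1 : ℝ) := fun p => by
    rw [slopeSum_add hf hg, add_smul]
  simp only [laplacian, h]
  rw [finsum_add_distrib hf.finite_support_slopeSum_smul hg.finite_support_slopeSum_smul,
    WithDensityᵥEq.congr_ae (secondDeriv_add_ae hf hg), withDensityᵥ_add hf.2.2 hg.2.2]
  abel

theorem laplacian_const_smul (c : ℝ) (f : Γ.Point → ℝ) :
    Γ.laplacian (c • f) = c • Γ.laplacian f := by
  simp only [laplacian, slopeSum_const_smul, secondDeriv_const_smul, withDensityᵥ_smul, mul_smul]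
  rw [← smul_finsum, smul_sub, smul_neg]

theorem MemZh.sub (hf : Γ.MemZh f) (hg : Γ.MemZh g) : Γ.MemZh (f - g) := by
  rw [sub_eq_add_neg, ← neg_one_smul ℝ g]
  exact hf.add (hg.const_smul _)

theorem laplacian_sub (hf : Γ.MemZh f) (hg : Γ.MemZh g) :
    Γ.laplacian (f - g) = Γ.laplacian f - Γ.laplacian g := by
  rw [sub_eq_add_neg, ← neg_one_smul ℝ g, laplacian_add hf (hg.const_smul _),
    laplacian_const_smul]
  ext s hs
  simp [sub_eq_add_neg]

end MemZh
end MetrizedGraph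

/-! ### The Laplacian as a sum over edges, and constancy of harmonic functions. -/

theorem HasDerivAt.hasDerivWithinAt_Ici_of_eqOn {u v : ℝ → ℝ} {a b c t : ℝ} (hv : HasDerivAt v c t)
    (h : EqOn u v (Icc a b)) (hat : a ≤ t) (htb : t < b) : HasDerivWithinAt u c (Ici t) t := by
  refine hv.hasDerivWithinAt.congr_of_eventuallyEq ?_ (h ⟨hat, htb.le⟩)
  filter_upwards [Ico_mem_nhdsGE htb] with s hs using h ⟨hat.trans hs.1, hs.2.le⟩

theorem HasDerivAt.hasDerivWithinAt_Iic_of_eqOn {u v : ℝ → ℝ} {a b c t : ℝ} (hv : HasDerivAt v c t)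
    (h : EqOn u v (Icc a b)) (hat : a < t) (htb : t ≤ b) : HasDerivWithinAt u c (Iic t) t := by
  refine hv.hasDerivWithinAt.congr_of_eventuallyEq ?_ (h ⟨hat.le, htb⟩)
  filter_upwards [Ioc_mem_nhdsLE hat] with s hs using h ⟨hs.1.le, hs.2.trans htb⟩

namespace MetrizedGraph

section Laplacian

variable {V E : Type*} {Γ : MetrizedGraph V E} [Fintype E] {f : Γ.Point → ℝ}

theorem withDensityᵥ_length_eq_sum {F : Γ.Point → ℝ} {k : E → ℝ}
    (h : ∀ e, F =ᵐ[Γ.edgeLength e] fun _ => k e) :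
    Γ.length.withDensityᵥ F = ∑ e, k e • (Γ.edgeLength e).toSignedMeasure := by
  have hi : Integrable F Γ.length :=
    Γ.integrable_length_iff.2 fun e => (integrable_const (k e)).congr (h e).symm
  ext s hs
  rw [withDensityᵥ_apply hi hs, length_eq_sum_edgeLength,
    show (∑ e, Γ.edgeLength e).restrict s = ∑ e, (Γ.edgeLength e).restrict s from
      map_sum (Measure.restrictₗ s) _ _,
    integral_finsetSum_measure]
  · rw [_root_.sum_apply]
    refine Finset.sum_congr rfl fun e _ => ?_
    rw [integral_congr_ae (ae_restrict_of_ae (h e))]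
    simp [Measure.toSignedMeasure_apply_measurable hs, mul_comm]
  · exact fun e _ => (Γ.integrable_length_iff.1 hi e).restrict

/-- Exchanging the sums over vertices and edges regroups the vertex masses by the two ends of each
edge, so self-loops need no separate treatment. The set `T` collects the kinks inside edges. -/
theorem laplacian_eq_sum [Fintype V] {α β : E → ℝ}
    (hα : ∀ e, HasDerivWithinAt (fun s => f (Γ.param e s)) (α e) (Ici 0) 0)
    (hβ : ∀ e, HasDerivWithinAt (fun s => f (Γ.param e s)) (β e) (Iic (Γ.len e)) (Γ.len e))
    (T : Finset Γ.Point) (hT : ∀ v, .vertex v ∉ T)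
    (hT' : ∀ e t, .inner e t ∉ T → Γ.slopeSum f (.inner e t) = 0) :
    Γ.laplacian f = -Γ.length.withDensityᵥ (Γ.secondDeriv f) - ∑ p ∈ T, Γ.slopeSum f p • Γ.dirac p
      - ∑ e, (α e • Γ.dirac (.vertex (Γ.tail e)) - β e • Γ.dirac (.vertex (Γ.head e))) := by
  classical
  have hsupp : (Function.support fun p => Γ.slopeSum f p • VectorMeasure.dirac p (1 : ℝ)) ⊆
      (T ∪ Finset.univ.image Point.vertex : Finset Γ.Point) := by
    intro p hp
    by_contra hpT
    simp only [Finset.coe_union, Finset.coe_image, Finset.coe_univ, image_univ, mem_union,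
      mem_range, not_or, not_exists] at hpT
    cases p with
    | vertex v => exact hpT.2 v rfl
    | inner e t => exact hp (by simp [hT' e t (by simpa using hpT.1)])
  have hdisj : Disjoint T (Finset.univ.image Point.vertex) := by
    rw [Finset.disjoint_left]
    rintro p hp hp'
    obtain ⟨v, -, rfl⟩ := Finset.mem_image.1 hp'
    exact hT v hp
  have hv (v : V) : Γ.slopeSum f (.vertex v) • VectorMeasure.dirac (Point.vertex v) (1 : ℝ) =
      ∑ e, ((if Γ.tail e = v then α e • Γ.dirac (.vertex (Γ.tail e)) else 0) -
        (if Γ.head e = v then β e • Γ.dirac (.vertex (Γ.head e)) else 0)) := by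
    rw [slopeSum, Finset.sum_smul]
    refine Finset.sum_congr rfl fun e _ => ?_
    rw [(hα e).derivWithin (uniqueDiffOn_Ici _ _ self_mem_Ici),
      (hβ e).derivWithin (uniqueDiffOn_Iic _ _ self_mem_Iic), dirac, dirac]
    ext s hs
    split_ifs with h1 h2 h2 <;> simp [h1, h2, add_mul, sub_eq_add_neg]
  have hsum : ∑ v, Γ.slopeSum f (.vertex v) • VectorMeasure.dirac (Point.vertex v) (1 : ℝ) =
      ∑ e, (α e • Γ.dirac (.vertex (Γ.tail e)) - β e • Γ.dirac (.vertex (Γ.head e))) := by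
    simp only [hv]
    rw [Finset.sum_comm]
    refine Finset.sum_congr rfl fun e _ => ?_
    rw [Finset.sum_sub_distrib]
    simp
  rw [laplacian, finsum_eq_sum_of_support_subset _ hsupp, Finset.sum_union hdisj,
    Finset.sum_image (fun _ _ _ _ h => by injection h), hsum, sub_sub]
  rfl

/-- The length measure has no atoms, so the mass at a point sees only the Dirac part. -/
theorem MemZh.laplacian_apply_singleton (hf : Γ.MemZh f) (p : Γ.Point) :
    Γ.laplacian f {p} = -Γ.slopeSum f p := by
  classical
  rw [laplacian, finsum_eq_sum_of_support_subset _
    (s := insert p hf.finite_support_slopeSum_smul.toFinset) (by simp)]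
  rw [_root_.sub_apply, _root_.neg_apply, withDensityᵥ_apply hf.2.2 (measurableSet_singleton p),
    _root_.sum_apply, Measure.restrict_eq_zero.2
      (Γ.length_eq_zero_of_finite (finite_singleton p))]
  rw [Finset.sum_eq_single p]
  · simp
  · intro q _ hq
    simp [VectorMeasure.dirac_apply_of_notMem (s := {p}) (x := q) (by simpa using hq)]
  · simp

theorem MemZh.slopeSum_eq_zero (hf : Γ.MemZh f) (h : Γ.laplacian f = 0) (p : Γ.Point) :
    Γ.slopeSum f p = 0 := by
  have := hf.laplacian_apply_singleton p
  rw [h] at this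
  simpa using this.symm

theorem MemZh.deriv_deriv_ae_eq_zero (hf : Γ.MemZh f) (h : Γ.laplacian f = 0) (e : E) :
    ∀ᵐ t ∂volume.restrict (Ioo 0 (Γ.len e)), deriv (deriv fun s => f (Γ.param e s)) t = 0 := by
  have h1 : Γ.length.withDensityᵥ (Γ.secondDeriv f) = Γ.length.withDensityᵥ 0 := by
    simpa [laplacian, hf.slopeSum_eq_zero h] using h
  have h2 := Γ.ae_length_iff.1 (hf.2.2.ae_eq_of_withDensityᵥ_eq (integrable_zero _ _ _) h1) e
  filter_upwards [ae_of_ae_map (Γ.measurable_param e).aemeasurable h2,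
    self_mem_ae_restrict measurableSet_Ioo] with t ht ht'
  simpa [Γ.param_of_mem ht', secondDeriv] using ht

/-- The two one-sided derivatives agree, and they are the one-sided limits of the derivative. This
also covers the exceptional points. -/
theorem MemZh.differentiableAt_of_slopeSum_eq_zero (hf : Γ.MemZh f) {e : E} {t : ℝ}
    (ht : t ∈ Ioo 0 (Γ.len e)) (h : Γ.slopeSum f (.inner e ⟨t, ht⟩) = 0) :
    DifferentiableAt ℝ (fun s => f (Γ.param e s)) t ∧
      ContinuousAt (deriv fun s => f (Γ.param e s)) t := by
  obtain ⟨c, hc, hc'⟩ := hf.exists_hasDerivWithinAt_Ici e ⟨ht.1.le, ht.2⟩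
  obtain ⟨d, hd, hd'⟩ := hf.exists_hasDerivWithinAt_Iic e ⟨ht.1, ht.2.le⟩
  simp only [slopeSum] at h
  rw [hc'.derivWithin (uniqueDiffOn_Ici _ _ self_mem_Ici),
    hd'.derivWithin (uniqueDiffOn_Iic _ _ self_mem_Iic), sub_eq_zero] at h
  subst h
  have h := hc'.union hd'
  rw [union_comm, Iic_union_Ici, hasDerivWithinAt_univ] at h
  refine ⟨h.differentiableAt, continuousAt_iff_continuous_left'_right'.2 ⟨?_, ?_⟩⟩
  · simpa [ContinuousWithinAt, h.deriv] using hd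
  · simpa [ContinuousWithinAt, h.deriv] using hc

theorem MemZh.exists_affine (hf : Γ.MemZh f) (h : Γ.laplacian f = 0) (e : E) :
    ∃ c, ∀ t ∈ Icc 0 (Γ.len e), f (Γ.param e t) = f (Γ.param e 0) + c * t := by
  have hL := Γ.len_pos e
  have hd (t : ℝ) (ht : t ∈ Ioo 0 (Γ.len e)) :=
    hf.differentiableAt_of_slopeSum_eq_zero ht (hf.slopeSum_eq_zero h _)
  have hz := hf.deriv_deriv_ae_eq_zero h e
  have hcont := hf.1.comp (Γ.continuous_param e)
  obtain ⟨-, ⟨S, hS, -, hS'⟩, -⟩ := hf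
  set u := fun s => f (Γ.param e s) with hu
  have hle (s t : ℝ) (hs : s ∈ Ioo 0 (Γ.len e)) (ht : t ∈ Ioo 0 (Γ.len e)) (hst : s ≤ t) :
      deriv u s = deriv u t := by
    have hsub : Icc s t ⊆ Ioo 0 (Γ.len e) := fun x hx => ⟨hs.1.trans_le hx.1, hx.2.trans_lt ht.2⟩
    have hz' : ∀ᵐ x ∂volume.restrict (Ioc s t), deriv (deriv u) x = 0 :=
      ae_restrict_of_ae_restrict_of_subset (Ioc_subset_Icc_self.trans hsub) hz
    -- The first derivative is continuous, is differentiable off a finite set and has derivative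
    -- zero almost everywhere, hence is constant.
    have := integral_eq_of_hasDerivAt_off_countable_of_le (deriv u) (deriv (deriv u))
      hst (Γ.finite_param_preimage e hS).countable
      (fun x hx => (hd x (hsub hx)).2.continuousWithinAt) (fun x hx => ?_) ?_
    · rw [intervalIntegral.integral_of_le hst, integral_congr_ae hz'] at this
      simp only [integral_zero] at this
      linarith
    · have hx' := hsub (Ioo_subset_Icc_self hx.1)
      have hv : ContDiffOn ℝ 1 (deriv u) _ :=
        (hS' e).deriv_of_isOpen (Γ.isOpen_param_notMem e hS) (by norm_num)
      exact ((hv.differentiableOn (by norm_num)).differentiableAt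
        ((Γ.isOpen_param_notMem e hS).mem_nhds ⟨hx', fun h => hx.2 ⟨hx', h⟩⟩)).hasDerivAt
    · rw [intervalIntegrable_iff_integrableOn_Ioc_of_le hst]
      exact (integrable_zero _ _ _).congr (hz'.mono fun x hx => hx.symm)
  -- The midpoint is an arbitrary interior point at which to read the constant slope.
  refine ⟨deriv u (Γ.len e / 2), fun t ht => ?_⟩
  have := integral_eq_of_hasDerivAt_off_countable_of_le u
    (fun _ => deriv u (Γ.len e / 2)) ht.1 countable_empty hcont.continuousOn (fun x hx => ?_)
    (by simp)
  · simp only [intervalIntegral.integral_const, smul_eq_mul, sub_zero] at this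
    change u t = u 0 + _
    linarith
  · have hx' : x ∈ Ioo 0 (Γ.len e) := ⟨hx.1.1, hx.1.2.trans_le ht.2⟩
    have hm : Γ.len e / 2 ∈ Ioo 0 (Γ.len e) := ⟨by linarith, by linarith⟩
    have : deriv u (Γ.len e / 2) = deriv u x := by
      rcases le_total (Γ.len e / 2) x with h | h
      · exact hle _ _ hm hx' h
      · exact (hle _ _ hx' hm h).symm
    rw [this]
    exact (hd x hx').1.hasDerivAt

omit [Fintype E] in
-- Connectedness of the graph enters the proof only here.
theorem eq_of_forall_tail_eq_head (Γ : MetrizedGraph V E) {w : V → ℝ}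
    (h : ∀ e, w (Γ.tail e) = w (Γ.head e)) (a b : V) : w a = w b := by
  induction Γ.connected a b with
  | rel x y hxy =>
    obtain ⟨e, rfl, rfl⟩ := hxy
    exact h e
  | refl x => rfl
  | symm x y _ ih => exact ih.symm
  | trans x y z _ _ h1 h2 => exact h1.trans h2

theorem MemZh.eq_of_laplacian_eq_zero [Fintype V] (hf : Γ.MemZh f) (h : Γ.laplacian f = 0)
    (p q : Γ.Point) : f p = f q := by
  classical
  choose c hc using hf.exists_affine h
  have hd (e : E) (t : ℝ) :
      HasDerivAt (fun t => f (Γ.param e 0) + c e * t) (c e) t := by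
    simpa using ((hasDerivAt_id t).const_mul (c e)).const_add (f (Γ.param e 0))
  have hc' (e : E) : f (.vertex (Γ.head e)) = f (.vertex (Γ.tail e)) + c e * Γ.len e := by
    rw [← Γ.param_len, hc e _ ⟨(Γ.len_pos e).le, le_rfl⟩, Γ.param_zero]
  have hv (v : V) : ∑ e, ((if Γ.tail e = v then c e else 0) + if Γ.head e = v then -c e else 0)
      = 0 := by
    refine Eq.trans ?_ (hf.slopeSum_eq_zero h (.vertex v))
    simp only [slopeSum]
    refine Finset.sum_congr rfl fun e _ => ?_
    rw [((hd e 0).hasDerivWithinAt_Ici_of_eqOn (hc e) le_rfl (Γ.len_pos e)).derivWithin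
        (uniqueDiffOn_Ici _ _ self_mem_Ici),
      ((hd e _).hasDerivWithinAt_Iic_of_eqOn (hc e) (Γ.len_pos e) le_rfl).derivWithin
        (uniqueDiffOn_Iic _ _ self_mem_Iic)]
  -- Pairing Kirchhoff's law `hv` with the vertex values of `f` and summing by parts gives minus the
  -- energy.
  have hsum : ∑ e, c e ^ 2 * Γ.len e = 0 := by
    have : ∑ v, f (.vertex v) * ∑ e, ((if Γ.tail e = v then c e else 0) +
        if Γ.head e = v then -c e else 0) = 0 := by simp [hv]
    simp only [Finset.mul_sum] at this
    rw [Finset.sum_comm] at this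
    simp only [mul_add, Finset.sum_add_distrib, mul_ite, mul_zero, Finset.sum_ite_eq,
      Finset.mem_univ, if_true] at this
    rw [← Finset.sum_add_distrib] at this
    rw [← neg_eq_zero, ← Finset.sum_neg_distrib, ← this]
    refine Finset.sum_congr rfl fun e _ => ?_
    rw [hc' e]
    ring
  have hc0 (e : E) : c e = 0 := by
    have := (Finset.sum_eq_zero_iff_of_nonneg fun e _ =>
      mul_nonneg (sq_nonneg (c e)) (Γ.len_pos e).le).1 hsum e (Finset.mem_univ e)
    simpa [(Γ.len_pos e).ne'] using this
  have hV (a b : V) : f (.vertex a) = f (.vertex b) :=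
    Γ.eq_of_forall_tail_eq_head (w := fun v => f (.vertex v)) (fun e => by simp [hc' e, hc0]) a b
  have key (p : Γ.Point) : ∃ v, f p = f (.vertex v) := by
    cases p with
    | vertex v => exact ⟨v, rfl⟩
    | inner e t =>
      refine ⟨Γ.tail e, ?_⟩
      rw [← Γ.param_coe, hc e t ⟨t.2.1.le, t.2.2.le⟩, hc0, zero_mul, add_zero, Γ.param_zero]
  obtain ⟨a, ha⟩ := key p
  obtain ⟨b, hb⟩ := key q
  rw [ha, hb, hV]

end Laplacian
-- Functions that are quadratic on every edge.
section Quadratic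

variable {V E : Type*} {Γ : MetrizedGraph V E} [Fintype E] {f : Γ.Point → ℝ} {a b c : E → ℝ}

/-- `f` restricts on every edge `e` to the polynomial `a e + b e * t + c e * t ^ 2`. -/
def IsQuadratic (Γ : MetrizedGraph V E) (f : Γ.Point → ℝ) (a b c : E → ℝ) : Prop :=
  ∀ e, ∀ t ∈ Icc 0 (Γ.len e), f (Γ.param e t) = a e + b e * t + c e * t ^ 2

theorem hasDerivAt_quadratic (a b c t : ℝ) :
    HasDerivAt (fun t => a + b * t + c * t ^ 2) (b + 2 * c * t) t := by
  refine ((((hasDerivAt_id t).const_mul b).const_add a).add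
    ((hasDerivAt_pow 2 t).const_mul c)).congr_deriv ?_
  simp
  ring

theorem deriv_deriv_quadratic (a b c t : ℝ) :
    deriv (deriv fun t => a + b * t + c * t ^ 2) t = 2 * c := by
  have : (deriv fun t => a + b * t + c * t ^ 2) = fun t => b + 2 * c * t :=
    funext fun t => (hasDerivAt_quadratic a b c t).deriv
  rw [this]
  simp

omit [Fintype E] in
theorem IsQuadratic.secondDeriv_inner (hf : Γ.IsQuadratic f a b c) (e : E)
    (t : Ioo (0 : ℝ) (Γ.len e)) : Γ.secondDeriv f (.inner e t) = 2 * c e := by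
  have h : (fun s => f (Γ.param e s)) =ᶠ[𝓝 (t : ℝ)] fun s => a e + b e * s + c e * s ^ 2 := by
    filter_upwards [Ioo_mem_nhds t.2.1 t.2.2] with s hs using hf e s ⟨hs.1.le, hs.2.le⟩
  simp only [secondDeriv]
  rw [h.deriv.deriv_eq, deriv_deriv_quadratic]

omit [Fintype E] in
theorem IsQuadratic.secondDeriv_ae_eq (hf : Γ.IsQuadratic f a b c) (e : E) :
    Γ.secondDeriv f =ᵐ[Γ.edgeLength e] fun _ => 2 * c e := by
  filter_upwards [Γ.ae_edgeLength_mem e] with p ⟨t, ht⟩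
  rw [← ht, hf.secondDeriv_inner]

theorem IsQuadratic.memZh [Finite V] (hf : Γ.IsQuadratic f a b c) : Γ.MemZh f := by
  refine ⟨Γ.continuous_iff_continuousOn_param.2 fun e => ?_, ⟨range .vertex, finite_range _,
    subset_rfl, fun e => ?_⟩, Γ.integrable_length_iff.2 fun e =>
      (integrable_const _).congr (hf.secondDeriv_ae_eq e).symm⟩
  · exact (Continuous.continuousOn (by fun_prop)).congr (hf e)
  · refine (ContDiff.contDiffOn (f := fun s => a e + b e * s + c e * s ^ 2) (by fun_prop)).congr
      fun t ht => hf e t ⟨ht.1.1.le, ht.1.2.le⟩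

theorem IsQuadratic.laplacian_eq [Fintype V] (hf : Γ.IsQuadratic f a b c) :
    Γ.laplacian f = ∑ e, ((-(2 * c e)) • (Γ.edgeLength e).toSignedMeasure
      + (-b e) • Γ.dirac (.vertex (Γ.tail e))
      + (b e + 2 * c e * Γ.len e) • Γ.dirac (.vertex (Γ.head e))) := by
  have hα (e : E) : HasDerivWithinAt (fun s => f (Γ.param e s)) (b e) (Ici 0) 0 := by
    simpa using (hasDerivAt_quadratic (a e) (b e) (c e) 0).hasDerivWithinAt_Ici_of_eqOn (hf e)
      le_rfl (Γ.len_pos e)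
  have hβ (e : E) := (hasDerivAt_quadratic (a e) (b e) (c e) (Γ.len e)).hasDerivWithinAt_Iic_of_eqOn
    (hf e) (Γ.len_pos e) le_rfl
  rw [laplacian_eq_sum hα hβ ∅ (by simp) fun e t _ => ?_,
    withDensityᵥ_length_eq_sum hf.secondDeriv_ae_eq]
  · ext s hs
    simp only [_root_.sub_apply, _root_.neg_apply, _root_.sum_apply, _root_.add_apply,
      _root_.smul_apply, Finset.sum_empty, Finset.sum_add_distrib, Finset.sum_sub_distrib,
      _root_.zero_apply, smul_eq_mul, neg_mul, Finset.sum_neg_distrib]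
    ring
  · refine Γ.slopeSum_inner_of_differentiableAt f e t ?_
    refine (hasDerivAt_quadratic (a e) (b e) (c e) t).differentiableAt.congr_of_eventuallyEq ?_
    filter_upwards [Ioo_mem_nhds t.2.1 t.2.2] with s hs using hf e s ⟨hs.1.le, hs.2.le⟩

omit [Fintype E] in
theorem isQuadratic_const (r : ℝ) : Γ.IsQuadratic (fun _ => r) (fun _ => r) 0 0 := by
  intro e t _
  simp

theorem memZh_const [Finite V] (r : ℝ) : Γ.MemZh fun _ => r := (isQuadratic_const r).memZh

theorem laplacian_const [Fintype V] (r : ℝ) : Γ.laplacian (fun _ => r) = 0 := by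
  rw [(isQuadratic_const r).laplacian_eq]
  simp

end Quadratic

/-! ### Tent functions: the Dirichlet Green functions of single edges. -/

section Tent

variable {V E : Type*} (Γ : MetrizedGraph V E)

open Classical in
/-- The coordinate of a point in the interior of the edge `e`, and `0` outside of it. -/
noncomputable def coord (e : E) : Γ.Point → ℝ
  | .vertex _ => 0
  | .inner e' t => if e' = e then t else 0

/-- The Green function of the segment `[0, L]` with the Dirichlet boundary condition. -/
noncomputable def segmentGreen (L s t : ℝ) : ℝ := min s t - s * t / L

theorem segmentGreen_comm (L s t : ℝ) : segmentGreen L s t = segmentGreen L t s := by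
  rw [segmentGreen, segmentGreen, min_comm, mul_comm]

theorem segmentGreen_zero_left (L : ℝ) {t : ℝ} (ht : 0 ≤ t) : segmentGreen L 0 t = 0 := by
  simp [segmentGreen, ht]

theorem segmentGreen_self_left {L t : ℝ} (hL : 0 < L) (ht : t ≤ L) : segmentGreen L L t = 0 := by
  rw [segmentGreen, min_eq_right ht]
  field_simp
  ring

variable {Γ}

theorem coord_mem_Ico (e : E) (p : Γ.Point) : Γ.coord e p ∈ Ico 0 (Γ.len e) := by
  cases p with
  | vertex v => exact ⟨le_rfl, Γ.len_pos e⟩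
  | inner e' t =>
    simp only [coord]
    split_ifs with h
    · subst h
      exact ⟨t.2.1.le, t.2.2⟩
    · exact ⟨le_rfl, Γ.len_pos e⟩

/-- At `t = len e` the coordinate jumps to 0, harmlessly: `segmentGreen` vanishes at both ends of
the segment. -/
theorem segmentGreen_coord_param (e : E) {t s : ℝ} (ht : t ∈ Icc 0 (Γ.len e))
    (hs : s ∈ Ico 0 (Γ.len e)) :
    segmentGreen (Γ.len e) (Γ.coord e (Γ.param e t)) s = segmentGreen (Γ.len e) t s := by
  rcases eq_or_lt_of_le ht.1 with rfl | h0
  · simp [param_zero, coord]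
  rcases eq_or_lt_of_le ht.2 with rfl | hL
  · rw [param_len, coord, segmentGreen_zero_left _ hs.1,
      segmentGreen_self_left (Γ.len_pos e) hs.2.le]
  · simp [Γ.param_of_mem ⟨h0, hL⟩, coord]

theorem coord_param_of_ne {e e' : E} (h : e' ≠ e) (t : ℝ) : Γ.coord e (Γ.param e' t) = 0 := by
  unfold param
  split_ifs <;> simp [coord, h]

/-- The function supported on the edge `e` which is affine on both sides of the point with
coordinate `s`. -/
noncomputable def tent (Γ : MetrizedGraph V E) (e : E) (s : ℝ) (p : Γ.Point) : ℝ :=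
  segmentGreen (Γ.len e) (Γ.coord e p) s

theorem tent_param (e : E) {s t : ℝ} (hs : s ∈ Ico 0 (Γ.len e)) (ht : t ∈ Icc 0 (Γ.len e)) :
    Γ.tent e s (Γ.param e t) = min t s - t * s / Γ.len e :=
  segmentGreen_coord_param e ht hs

theorem tent_param_of_ne {e e' : E} (h : e' ≠ e) {s : ℝ} (hs : 0 ≤ s) (t : ℝ) :
    Γ.tent e s (Γ.param e' t) = 0 := by
  rw [tent, coord_param_of_ne h, segmentGreen_zero_left _ hs]

theorem tent_zero (e : E) : Γ.tent e 0 = 0 := by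
  funext p
  rw [tent, segmentGreen_comm, segmentGreen_zero_left _ (coord_mem_Ico e p).1]
  rfl

/-- The zero quadratic term gives the shape needed by `hasDerivAt_quadratic`. -/
theorem eqOn_tent_left (e : E) {s : ℝ} (hs : s ∈ Ioo 0 (Γ.len e)) :
    EqOn (fun t => Γ.tent e s (Γ.param e t)) (fun t => 0 + (1 - s / Γ.len e) * t + 0 * t ^ 2)
      (Icc 0 s) := fun t ht => by
  simp only [tent_param e ⟨hs.1.le, hs.2⟩ ⟨ht.1, ht.2.trans hs.2.le⟩, min_eq_left ht.2]
  ring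

theorem eqOn_tent_right (e : E) {s : ℝ} (hs : s ∈ Ioo 0 (Γ.len e)) :
    EqOn (fun t => Γ.tent e s (Γ.param e t)) (fun t => s + (- s / Γ.len e) * t + 0 * t ^ 2)
      (Icc s (Γ.len e)) := fun t ht => by
  simp only [tent_param e ⟨hs.1.le, hs.2⟩ ⟨hs.1.le.trans ht.1, ht.2⟩, min_eq_right ht.1]
  ring

theorem tent_eventuallyEq_affine (e : E) {s : ℝ} (hs : s ∈ Ioo 0 (Γ.len e)) {e' : E}
    {t : ℝ} (ht : t ∈ Ioo 0 (Γ.len e')) (h : Γ.param e' t ≠ Γ.param e s) :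
    ∃ a b : ℝ, (fun t => Γ.tent e s (Γ.param e' t)) =ᶠ[𝓝 t] fun t => a + b * t + 0 * t ^ 2 := by
  by_cases he : e' = e
  · subst he
    rcases lt_trichotomy t s with hts | rfl | hts
    · exact ⟨_, _, (eqOn_tent_left e' hs).eventuallyEq_of_mem (Icc_mem_nhds ht.1 hts)⟩
    · exact absurd rfl h
    · exact ⟨_, _, (eqOn_tent_right e' hs).eventuallyEq_of_mem (Icc_mem_nhds hts ht.2)⟩
  · exact ⟨0, 0, Eventually.of_forall fun t => by simp [tent_param_of_ne he hs.1.le]⟩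

theorem continuous_tent (e : E) {s : ℝ} (hs : s ∈ Ico 0 (Γ.len e)) :
    Continuous (Γ.tent e s) := by
  refine Γ.continuous_iff_continuousOn_param.2 fun e' => ?_
  by_cases he : e' = e
  · subst he
    refine ContinuousOn.congr (f := fun t => min t s - t * s / Γ.len e')
      (Continuous.continuousOn (by fun_prop)) fun t ht => tent_param e' hs ht
  · simp only [tent_param_of_ne he hs.1]
    exact continuousOn_const

variable [Fintype E]

theorem secondDeriv_tent_ae_eq_zero (e : E) {s : ℝ} (hs : s ∈ Ioo 0 (Γ.len e)) :
    Γ.secondDeriv (Γ.tent e s) =ᵐ[Γ.length] 0 := by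
  have h0 : ∀ᵐ p ∂Γ.length, p ∉ ({Γ.param e s} : Set Γ.Point) :=
    measure_eq_zero_iff_ae_notMem.1 (Γ.length_eq_zero_of_finite (finite_singleton _))
  filter_upwards [h0] with p hp
  cases p with
  | vertex v => rfl
  | inner e' t =>
    rw [← Γ.param_coe] at hp
    obtain ⟨a, b, h⟩ := tent_eventuallyEq_affine e hs t.2 hp
    simp only [secondDeriv]
    rw [h.deriv.deriv_eq, deriv_deriv_quadratic]
    simp

theorem memZh_tent [Finite V] (e : E) {s : ℝ} (hs : s ∈ Ioo 0 (Γ.len e)) :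
    Γ.MemZh (Γ.tent e s) := by
  refine ⟨continuous_tent e ⟨hs.1.le, hs.2⟩, ⟨insert (Γ.param e s) (range .vertex),
    (finite_range _).insert _, subset_insert _ _, fun e' t ht => ?_⟩,
    (integrable_zero _ _ _).congr (secondDeriv_tent_ae_eq_zero e hs).symm⟩
  obtain ⟨a, b, h⟩ := tent_eventuallyEq_affine e hs ht.1 fun h => ht.2 (Or.inl h)
  exact (ContDiffAt.congr_of_eventuallyEq (ContDiff.contDiffAt (by fun_prop)) h).contDiffWithinAt

theorem slopeSum_tent (e : E) {s : ℝ} (hs : s ∈ Ioo 0 (Γ.len e)) :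
    Γ.slopeSum (Γ.tent e s) (.inner e ⟨s, hs⟩) = -1 := by
  simp only [slopeSum]
  rw [((hasDerivAt_quadratic _ _ _ s).hasDerivWithinAt_Ici_of_eqOn (eqOn_tent_right e hs) le_rfl
      hs.2).derivWithin (uniqueDiffOn_Ici _ _ self_mem_Ici),
    ((hasDerivAt_quadratic _ _ _ s).hasDerivWithinAt_Iic_of_eqOn (eqOn_tent_left e hs) hs.1
      le_rfl).derivWithin (uniqueDiffOn_Iic _ _ self_mem_Iic)]
  ring

/-- Unit current enters at the apex and leaves through the two ends, in inverse proportion to their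
distances from it. -/
theorem laplacian_tent [Fintype V] (e : E) {s : ℝ} (hs : s ∈ Ioo 0 (Γ.len e)) :
    Γ.laplacian (Γ.tent e s) = Γ.dirac (.inner e ⟨s, hs⟩)
      - (1 - s / Γ.len e) • Γ.dirac (.vertex (Γ.tail e))
      - (s / Γ.len e) • Γ.dirac (.vertex (Γ.head e)) := by
  classical
  have h0 (e' : E) (he : e' ≠ e) : (fun t => Γ.tent e s (Γ.param e' t)) = fun _ => 0 :=
    funext fun t => tent_param_of_ne he hs.1.le t
  have hα (e' : E) : HasDerivWithinAt (fun t => Γ.tent e s (Γ.param e' t))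
      (if e' = e then 1 - s / Γ.len e else 0) (Ici 0) 0 := by
    split_ifs with he
    · subst he
      simpa using (hasDerivAt_quadratic _ _ _ 0).hasDerivWithinAt_Ici_of_eqOn
        (eqOn_tent_left e' hs) le_rfl hs.1
    · rw [h0 e' he]
      exact hasDerivWithinAt_const _ _ _
  have hβ (e' : E) : HasDerivWithinAt (fun t => Γ.tent e s (Γ.param e' t))
      (if e' = e then -s / Γ.len e else 0) (Iic (Γ.len e')) (Γ.len e') := by
    split_ifs with he
    · subst he
      simpa using (hasDerivAt_quadratic _ _ _ (Γ.len e')).hasDerivWithinAt_Iic_of_eqOn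
        (eqOn_tent_right e' hs) hs.2 le_rfl
    · rw [h0 e' he]
      exact hasDerivWithinAt_const _ _ _
  rw [laplacian_eq_sum hα hβ {.inner e ⟨s, hs⟩} (by simp) fun e' t ht => ?_,
    WithDensityᵥEq.congr_ae (secondDeriv_tent_ae_eq_zero e hs)]
  · rw [Finset.sum_eq_single e (fun e' _ he => by simp [he]) (by simp), Finset.sum_singleton,
      slopeSum_tent e hs]
    ext u hu
    simp
    ring
  · refine Γ.slopeSum_inner_of_differentiableAt _ e' t ?_
    obtain ⟨a, b, h⟩ := tent_eventuallyEq_affine e hs t.2 (e' := e') (by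
      rw [Γ.param_coe, Γ.param_of_mem hs]
      simpa using ht)
    exact (hasDerivAt_quadratic _ _ _ _).differentiableAt.congr_of_eventuallyEq h

end Tent
-- The Green matrix on the vertices.
section Green

variable {V E : Type*} (Γ : MetrizedGraph V E)

open Classical in
/-- The matrix of the sum of the combinatorial Laplacian (with conductances `1 / len e`) and of the
orthogonal projection onto the constants, up to scaling. -/
noncomputable def shiftedLaplacian [Fintype E] : Matrix V V ℝ :=
  Matrix.of fun u v => ∑ e, ((if Γ.head e = u then 1 else 0) - (if Γ.tail e = u then 1 else 0)) *
    ((if Γ.head e = v then 1 else 0) - (if Γ.tail e = v then 1 else 0)) / Γ.len e + 1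

variable [Fintype V] [Fintype E]

theorem dotProduct_shiftedLaplacian_mulVec (x w : V → ℝ) :
    x ⬝ᵥ (Γ.shiftedLaplacian.mulVec w) = ∑ e, (x (Γ.head e) - x (Γ.tail e)) *
      (w (Γ.head e) - w (Γ.tail e)) / Γ.len e + (∑ v, x v) * ∑ v, w v := by
  classical
  have h (w : V → ℝ) (e : E) : ∑ v, ((if Γ.head e = v then 1 else 0) -
      (if Γ.tail e = v then 1 else 0)) * w v = w (Γ.head e) - w (Γ.tail e) := by
    simp [sub_mul, Finset.sum_sub_distrib]
  have hw (u : V) : Γ.shiftedLaplacian.mulVec w u = ∑ e, ((if Γ.head e = u then 1 else 0) -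
      (if Γ.tail e = u then 1 else 0)) * ((w (Γ.head e) - w (Γ.tail e)) / Γ.len e) +
        ∑ v, w v := by
    simp only [Matrix.mulVec, dotProduct, shiftedLaplacian, Matrix.of_apply, add_mul, one_mul,
      Finset.sum_add_distrib, Finset.sum_mul]
    rw [Finset.sum_comm]
    congr 1
    refine Finset.sum_congr rfl fun e _ => ?_
    rw [← h w, Finset.sum_div, Finset.mul_sum]
    exact Finset.sum_congr rfl fun v _ => by ring
  simp only [dotProduct, hw, mul_add, Finset.sum_add_distrib, Finset.mul_sum, Finset.sum_mul]
  rw [Finset.sum_comm]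
  congr 1
  · refine Finset.sum_congr rfl fun e _ => ?_
    rw [← h x, Finset.sum_mul, Finset.sum_div]
    exact Finset.sum_congr rfl fun v _ => by ring
  · exact Finset.sum_comm

/-- The quadratic form is the energy plus the square of the sum. Zero energy forces a kernel vector
to be constant, and zero sum then forces it to vanish. -/
theorem isUnit_det_shiftedLaplacian [DecidableEq V] : IsUnit Γ.shiftedLaplacian.det := by
  rw [isUnit_iff_ne_zero]
  intro h
  obtain ⟨w, hw0, hw⟩ := Matrix.exists_mulVec_eq_zero_iff.2 h
  have := Γ.dotProduct_shiftedLaplacian_mulVec w w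
  rw [hw, dotProduct_zero] at this
  have h1 : 0 ≤ ∑ e, (w (Γ.head e) - w (Γ.tail e)) * (w (Γ.head e) - w (Γ.tail e)) / Γ.len e :=
    Finset.sum_nonneg fun e _ => div_nonneg (mul_self_nonneg _) (Γ.len_pos e).le
  have h2 := mul_self_nonneg (∑ v, w v)
  have h3 : ∑ v, w v = 0 := mul_self_eq_zero.1 (by linarith)
  have h4 := (Finset.sum_eq_zero_iff_of_nonneg fun e _ =>
    div_nonneg (mul_self_nonneg _) (Γ.len_pos e).le).1 (by linarith : ∑ e, (w (Γ.head e) -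
      w (Γ.tail e)) * (w (Γ.head e) - w (Γ.tail e)) / Γ.len e = 0)
  have h5 (e : E) : w (Γ.tail e) = w (Γ.head e) := by
    have := h4 e (Finset.mem_univ e)
    rw [div_eq_zero_iff, or_iff_left (Γ.len_pos e).ne', mul_self_eq_zero] at this
    linarith
  apply hw0
  funext v
  have h6 : ∑ u, w u = Fintype.card V • w v := by
    rw [Finset.sum_congr rfl fun u _ => Γ.eq_of_forall_tail_eq_head h5 u v]
    simp
  have : Nonempty V := Γ.nonempty
  rw [h3, eq_comm, smul_eq_zero] at h6
  exact h6.resolve_left Fintype.card_ne_zero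

open Classical in
/-- The Green matrix of the combinatorial Laplacian. -/
noncomputable def vertexGreen : Matrix V V ℝ := Γ.shiftedLaplacian⁻¹

theorem vertexGreen_comm (u v : V) : Γ.vertexGreen u v = Γ.vertexGreen v u := by
  classical
  have h : Γ.shiftedLaplacian.transpose = Γ.shiftedLaplacian := by
    ext u v
    simp [shiftedLaplacian, mul_comm]
  have h' : Γ.vertexGreen.transpose = Γ.vertexGreen := by
    rw [vertexGreen, Matrix.transpose_nonsing_inv, h]
  conv_lhs => rw [← h']
  rfl

/-- Weak form of QM = 1 - J/n, with n the number of vertices. -/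
theorem sum_vertexGreen (φ : V → ℝ) (v : V) :
    ∑ e, (Γ.vertexGreen (Γ.head e) v - Γ.vertexGreen (Γ.tail e) v) / Γ.len e *
      (φ (Γ.head e) - φ (Γ.tail e)) = φ v - (∑ u, φ u) / Fintype.card V := by
  classical
  have hinv : Γ.shiftedLaplacian * Γ.vertexGreen = 1 :=
    Matrix.mul_nonsing_inv _ Γ.isUnit_det_shiftedLaplacian
  have key (φ : V → ℝ) := Γ.dotProduct_shiftedLaplacian_mulVec φ fun u => Γ.vertexGreen u v
  have hmul : (Γ.shiftedLaplacian.mulVec fun u => Γ.vertexGreen u v) = Pi.single v 1 := by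
    funext u
    have := congrFun (congrFun hinv u) v
    rw [Matrix.mul_apply] at this
    simpa [Matrix.mulVec, dotProduct, Matrix.one_apply, Pi.single_apply] using this
  simp only [hmul, dotProduct_single_one] at key
  have : Nonempty V := Γ.nonempty
  -- Testing with the constant 1 kills the energy term and yields the column sums of M.
  have h1 : 1 = (Fintype.card V : ℝ) * ∑ u, Γ.vertexGreen u v := by simpa using key fun _ => 1
  have hn : (Fintype.card V : ℝ) ≠ 0 := by simp
  have h2 : ∑ u, Γ.vertexGreen u v = 1 / Fintype.card V := by
    field_simp
    linarith
  rw [key φ, h2]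
  have : ∀ e, (φ (Γ.head e) - φ (Γ.tail e)) * (Γ.vertexGreen (Γ.head e) v -
      Γ.vertexGreen (Γ.tail e) v) / Γ.len e = (Γ.vertexGreen (Γ.head e) v -
        Γ.vertexGreen (Γ.tail e) v) / Γ.len e * (φ (Γ.head e) - φ (Γ.tail e)) := fun e => by ring
  simp only [this]
  ring

/-- The energy pairing of columns `u` and `v` of M is symmetric; evaluating it both ways by
`sum_vertexGreen` leaves only the row sums to compare. -/
theorem sum_vertexGreen_eq (u v : V) :
    ∑ w, Γ.vertexGreen u w = ∑ w, Γ.vertexGreen v w := by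
  have h1 := Γ.sum_vertexGreen (Γ.vertexGreen u) v
  have h2 := Γ.sum_vertexGreen (Γ.vertexGreen v) u
  have h3 : ∑ e, (Γ.vertexGreen (Γ.head e) v - Γ.vertexGreen (Γ.tail e) v) / Γ.len e *
      (Γ.vertexGreen u (Γ.head e) - Γ.vertexGreen u (Γ.tail e)) =
      ∑ e, (Γ.vertexGreen (Γ.head e) u - Γ.vertexGreen (Γ.tail e) u) / Γ.len e *
      (Γ.vertexGreen v (Γ.head e) - Γ.vertexGreen v (Γ.tail e)) :=
    Finset.sum_congr rfl fun e _ => by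
      rw [Γ.vertexGreen_comm u, Γ.vertexGreen_comm u, Γ.vertexGreen_comm v, Γ.vertexGreen_comm v]
      ring
  rw [h1, h2, Γ.vertexGreen_comm v u] at h3
  have : Nonempty V := Γ.nonempty
  have hn : (Fintype.card V : ℝ) ≠ 0 := by simp
  field_simp at h3
  linarith

end Green

/-! ### Interpolation from the vertices to the edges. -/

section Interp

variable {V E : Type*} {Γ : MetrizedGraph V E}

/-- The extension of a function on the vertices to a function which is affine on all edges. -/
noncomputable def interp (Γ : MetrizedGraph V E) (w : V → ℝ) : Γ.Point → ℝ
  | .vertex v => w v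
  | .inner e t => w (Γ.tail e) + (w (Γ.head e) - w (Γ.tail e)) / Γ.len e * t

theorem interp_param (w : V → ℝ) (e : E) {t : ℝ} (ht : t ∈ Icc 0 (Γ.len e)) :
    Γ.interp w (Γ.param e t) =
      w (Γ.tail e) + (w (Γ.head e) - w (Γ.tail e)) / Γ.len e * t := by
  rcases eq_or_lt_of_le ht.1 with rfl | h0
  · simp [param_zero, interp]
  rcases eq_or_lt_of_le ht.2 with rfl | hL
  · have := (Γ.len_pos e).ne'
    rw [param_len, interp]
    field_simp
    ring
  · rw [Γ.param_of_mem ⟨h0, hL⟩, interp]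

theorem isQuadratic_interp (w : V → ℝ) :
    Γ.IsQuadratic (Γ.interp w) (fun e => w (Γ.tail e))
      (fun e => (w (Γ.head e) - w (Γ.tail e)) / Γ.len e) 0 := by
  intro e t ht
  simp [interp_param w e ht]

theorem interp_interp (M : V → V → ℝ) (x y : Γ.Point) :
    Γ.interp (fun u => Γ.interp (fun v => M u v) y) x =
      Γ.interp (fun v => Γ.interp (fun u => M u v) x) y := by
  cases x <;> cases y <;> simp only [interp] <;> ring

theorem laplacian_interp [Fintype V] [Fintype E] (w : V → ℝ) :
    Γ.laplacian (Γ.interp w) = ∑ e, ((w (Γ.head e) - w (Γ.tail e)) / Γ.len e) •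
      (Γ.dirac (.vertex (Γ.head e)) - Γ.dirac (.vertex (Γ.tail e))) := by
  rw [(isQuadratic_interp w).laplacian_eq]
  refine Finset.sum_congr rfl fun e _ => ?_
  ext s hs
  simp
  ring

theorem interp_add (w w' : V → ℝ) : Γ.interp (w + w') = Γ.interp w + Γ.interp w' := by
  funext p
  cases p <;> simp [interp] <;> ring

theorem interp_smul (c : ℝ) (w : V → ℝ) : Γ.interp (c • w) = c • Γ.interp w := by
  funext p
  cases p <;> simp [interp] <;> ring

end Interp
-- The Green function of the graph and the voltage function.
section Voltage

variable {V E : Type*} [Fintype V] [Fintype E] (Γ : MetrizedGraph V E)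

/-- A Green function of `Γ`: as a function of each variable its Laplacian is the difference of the
Dirac measure at the other variable and of the uniform measure on the vertices. -/
noncomputable def green (x y : Γ.Point) : ℝ :=
  ∑ e, segmentGreen (Γ.len e) (Γ.coord e x) (Γ.coord e y) +
    Γ.interp (fun u => Γ.interp (fun v => Γ.vertexGreen u v) y) x

/-- The uniform probability measure on the vertices. -/
noncomputable def uniformVertex : SignedMeasure Γ.Point :=
  (Fintype.card V : ℝ)⁻¹ • ∑ v, Γ.dirac (.vertex v)

theorem green_comm (x y : Γ.Point) : Γ.green x y = Γ.green y x := by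
  refine congrArg₂ (· + ·) (Finset.sum_congr rfl fun e _ => segmentGreen_comm _ _ _) ?_
  refine (interp_interp (fun u v => Γ.vertexGreen u v) x y).trans ?_
  simp only [Γ.vertexGreen_comm]

theorem green_vertex (v : V) :
    (fun x => Γ.green x (.vertex v)) = Γ.interp fun u => Γ.vertexGreen u v := by
  funext x
  have h (e : E) : segmentGreen (Γ.len e) (Γ.coord e x) (Γ.coord e (.vertex v)) = 0 := by
    rw [segmentGreen_comm]
    exact segmentGreen_zero_left _ (coord_mem_Ico e x).1
  simp [green, h, interp]

/-- This reduces a source inside an edge to sources at its ends: the end masses in `laplacian_tent`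
cancel exactly against those of the convex combination. -/
theorem green_inner (e : E) (s : Ioo 0 (Γ.len e)) :
    (fun x => Γ.green x (.inner e s)) = Γ.tent e s +
      ((1 - s / Γ.len e) • (fun x => Γ.green x (.vertex (Γ.tail e))) +
        (s / Γ.len e : ℝ) • fun x => Γ.green x (.vertex (Γ.head e))) := by
  rw [green_vertex, green_vertex, ← interp_smul, ← interp_smul, ← interp_add]
  funext x
  rw [green, Pi.add_apply, Finset.sum_eq_single e]
  · congr 1
    · simp [coord, tent]
    · congr 1
      funext u
      simp [interp]
      ring
  · intro e' _ he
    rw [segmentGreen_comm, ← Γ.param_coe, coord_param_of_ne he.symm,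
      segmentGreen_zero_left _ (coord_mem_Ico e' x).1]
  · simp

theorem laplacian_green_vertex (v : V) :
    Γ.laplacian (fun x => Γ.green x (.vertex v)) = Γ.dirac (.vertex v) - Γ.uniformVertex := by
  rw [green_vertex, laplacian_interp]
  ext s hs
  -- The test function sends a vertex to its Dirac mass on the set `s`, so one weak identity gives
  -- the equality of measures.
  have := Γ.sum_vertexGreen (fun u => Γ.dirac (.vertex u) s) v
  simp only [uniformVertex, _root_.sum_apply, _root_.smul_apply, _root_.sub_apply, smul_eq_mul]
  rw [this]
  ring

theorem memZh_green (y : Γ.Point) : Γ.MemZh fun x => Γ.green x y := by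
  have hv (v : V) : Γ.MemZh fun x => Γ.green x (.vertex v) := by
    rw [green_vertex]
    exact (isQuadratic_interp _).memZh
  cases y with
  | vertex v => exact hv v
  | inner e s =>
    rw [green_inner]
    exact (memZh_tent e s.2).add (((hv _).const_smul _).add ((hv _).const_smul _))

theorem laplacian_green (y : Γ.Point) :
    Γ.laplacian (fun x => Γ.green x y) = Γ.dirac y - Γ.uniformVertex := by
  cases y with
  | vertex v => exact Γ.laplacian_green_vertex v
  | inner e s =>
    have hv (v : V) := Γ.memZh_green (.vertex v)
    rw [green_inner, laplacian_add (memZh_tent e s.2) (((hv _).const_smul _).add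
      ((hv _).const_smul _)), laplacian_add ((hv _).const_smul _) ((hv _).const_smul _),
      laplacian_const_smul, laplacian_const_smul, laplacian_green_vertex, laplacian_green_vertex,
      laplacian_tent e s.2]
    ext u hu
    simp
    ring

theorem isPotential_green (z y : Γ.Point) : Γ.IsPotential z y fun x =>
    Γ.green x y - Γ.green x z - Γ.green z y + Γ.green z z := by
  have h := (Γ.memZh_green y).sub (Γ.memZh_green z)
  have hc : Γ.MemZh fun _ => Γ.green z z - Γ.green z y := memZh_const _
  have heq : (fun x => Γ.green x y - Γ.green x z - Γ.green z y + Γ.green z z) =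
      (fun x => Γ.green x y) - (fun x => Γ.green x z) + fun _ => Γ.green z z - Γ.green z y := by
    funext x
    simp
    ring
  refine ⟨heq ▸ h.add hc, ?_, by ring⟩
  rw [heq, laplacian_add h hc, laplacian_sub (Γ.memZh_green y) (Γ.memZh_green z), laplacian_const,
    laplacian_green, laplacian_green]
  abel

variable {Γ} in
theorem IsPotential.eq {z y : Γ.Point} {f g : Γ.Point → ℝ} (hf : Γ.IsPotential z y f)
    (hg : Γ.IsPotential z y g) : f = g := by
  funext x
  have h := (hf.1.sub hg.1).eq_of_laplacian_eq_zero (by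
    rw [laplacian_sub hf.1 hg.1, hf.2.1, hg.2.1, sub_self]) x z
  rw [Pi.sub_apply, Pi.sub_apply, hf.2.2, hg.2.2, sub_self] at h
  exact sub_eq_zero.1 h

theorem voltage_eq (z x y : Γ.Point) :
    Γ.voltage z x y = Γ.green x y - Γ.green x z - Γ.green z y + Γ.green z z :=
  congrFun ((Classical.epsilon_spec ⟨_, Γ.isPotential_green z y⟩ :
    Γ.IsPotential z y (Classical.epsilon (Γ.IsPotential z y))).eq (Γ.isPotential_green z y)) x

/-- On the diagonal the kink of `min` disappears and the tent part becomes t - t²/L; the rest is the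
quadratic form of M at the weights 1 - t/L and t/L of the two ends. -/
theorem isQuadratic_green_diag : Γ.IsQuadratic (fun x => Γ.green x x)
    (fun e => Γ.vertexGreen (Γ.tail e) (Γ.tail e))
    (fun e => 1 + 2 * (Γ.vertexGreen (Γ.tail e) (Γ.head e) -
      Γ.vertexGreen (Γ.tail e) (Γ.tail e)) / Γ.len e)
    (fun e => -1 / Γ.len e + (Γ.vertexGreen (Γ.tail e) (Γ.tail e) - 2 *
      Γ.vertexGreen (Γ.tail e) (Γ.head e) + Γ.vertexGreen (Γ.head e) (Γ.head e)) /
        Γ.len e ^ 2) := by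
  intro e t ht
  have hL := (Γ.len_pos e).ne'
  have h : segmentGreen (Γ.len e) (Γ.coord e (Γ.param e t)) (Γ.coord e (Γ.param e t)) =
      t - t ^ 2 / Γ.len e := by
    rw [segmentGreen_coord_param e ht (coord_mem_Ico _ _), segmentGreen_comm]
    rcases eq_or_lt_of_le ht.2 with rfl | h
    -- At the head the coordinate is 0, and t - t²/L vanishes as well.
    · rw [param_len, coord, segmentGreen_zero_left _ ht.1]
      field_simp
      ring
    · rw [segmentGreen_coord_param e ht ⟨ht.1, h⟩, segmentGreen, min_self, sq]
  have h' (e' : E) (he : e' ≠ e) : segmentGreen (Γ.len e') (Γ.coord e' (Γ.param e t))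
      (Γ.coord e' (Γ.param e t)) = 0 := by
    rw [coord_param_of_ne he.symm, segmentGreen_zero_left _ le_rfl]
  simp only [green]
  rw [Finset.sum_eq_single e (fun e' _ he => h' e' he) (by simp), h, interp_param _ e ht,
    interp_param _ e ht, interp_param _ e ht, Γ.vertexGreen_comm (Γ.head e) (Γ.tail e)]
  field_simp
  ring

theorem memZh_green_diag : Γ.MemZh fun x => Γ.green x x := Γ.isQuadratic_green_diag.memZh

theorem voltage_eq_diag (p q : Γ.Point) : (fun x => Γ.voltage x p q) =
    (fun x => Γ.green x x) - (fun x => Γ.green x p) - (fun x => Γ.green x q) +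
      fun _ => Γ.green p q := by
  funext x
  simp [voltage_eq, Γ.green_comm p x]
  ring

theorem memZh_voltage (p q : Γ.Point) : Γ.MemZh fun x => Γ.voltage x p q := by
  rw [voltage_eq_diag]
  exact ((Γ.memZh_green_diag.sub (Γ.memZh_green p)).sub (Γ.memZh_green q)).add (memZh_const _)

theorem laplacian_voltage (p q : Γ.Point) : Γ.laplacian (fun x => Γ.voltage x p q) =
    Γ.laplacian (fun x => Γ.green x x) + (2 : ℝ) • Γ.uniformVertex - Γ.dirac p - Γ.dirac q := by
  have h1 := Γ.memZh_green_diag.sub (Γ.memZh_green p)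
  have h2 := h1.sub (Γ.memZh_green q)
  rw [voltage_eq_diag, laplacian_add h2 (memZh_const _), laplacian_const,
    laplacian_sub h1 (Γ.memZh_green q), laplacian_sub Γ.memZh_green_diag (Γ.memZh_green p),
    laplacian_green, laplacian_green]
  ext s hs
  simp
  ring

end Voltage
-- Integration of the Green function and existence of the canonical measure.
-- The value solves -w'' = 1 with w = 0 at both ends.
theorem integral_segmentGreen {L s : ℝ} (hs : s ∈ Icc 0 L) (hL : L ≠ 0) :
    ∫ t in (0 : ℝ)..L, segmentGreen L s t = s * (L - s) / 2 := by
  have hc : Continuous fun t => min s t := by fun_prop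
  have h1 : ∫ t in (0 : ℝ)..s, min s t = ∫ t in (0 : ℝ)..s, t :=
    intervalIntegral.integral_congr fun t ht => by
      rw [uIcc_of_le hs.1] at ht
      exact min_eq_right ht.2
  have h2 : ∫ t in s..L, min s t = ∫ _ in s..L, s :=
    intervalIntegral.integral_congr fun t ht => by
      rw [uIcc_of_le hs.2] at ht
      exact min_eq_left ht.1
  have h3 : ∫ t in (0 : ℝ)..L, min s t = s ^ 2 / 2 + s * (L - s) := by
    rw [← intervalIntegral.integral_add_adjacent_intervals (hc.intervalIntegrable 0 s)
      (hc.intervalIntegrable s L), h1, h2]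
    simp
    ring
  have h4 : ∫ t in (0 : ℝ)..L, s * t / L = s * L / 2 := by
    rw [intervalIntegral.integral_div, intervalIntegral.integral_const_mul, integral_id]
    field_simp
    ring
  unfold segmentGreen
  rw [intervalIntegral.integral_sub (hc.intervalIntegrable _ _)
    (Continuous.intervalIntegrable (by fun_prop) _ _), h3, h4]
  ring

section Integral

variable {V E : Type*} [Fintype V] [Fintype E] (Γ : MetrizedGraph V E)

theorem continuous_green (x : Γ.Point) : Continuous (Γ.green x) :=
  (Γ.memZh_green x).1.congr fun y => Γ.green_comm y x

theorem green_param (x : Γ.Point) (e : E) {t : ℝ} (ht : t ∈ Icc 0 (Γ.len e)) :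
    Γ.green x (Γ.param e t) = segmentGreen (Γ.len e) (Γ.coord e x) t +
      (Γ.green x (.vertex (Γ.tail e)) + (Γ.green x (.vertex (Γ.head e)) -
        Γ.green x (.vertex (Γ.tail e))) / Γ.len e * t) := by
  have h (e' : E) (he : e' ≠ e) : segmentGreen (Γ.len e') (Γ.coord e' (Γ.param e t))
      (Γ.coord e' x) = 0 := by
    rw [coord_param_of_ne he.symm, segmentGreen_zero_left _ (coord_mem_Ico e' x).1]
  have hv (v : V) : Γ.green x (.vertex v) = Γ.interp (fun u => Γ.vertexGreen v u) x := by
    simp only [Γ.vertexGreen_comm v]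
    exact congrFun (Γ.green_vertex v) x
  rw [green_comm, green, Finset.sum_eq_single e (fun e' _ he => h e' he) (by simp),
    segmentGreen_coord_param e ht (coord_mem_Ico _ _), interp_param _ e ht, hv, hv,
    segmentGreen_comm]

theorem integral_green_edgeLength (x : Γ.Point) (e : E) :
    ∫ y, Γ.green x y ∂Γ.edgeLength e = Γ.coord e x * (Γ.len e - Γ.coord e x) / 2 +
      (Γ.green x (.vertex (Γ.tail e)) + Γ.green x (.vertex (Γ.head e))) * Γ.len e / 2 := by
  have hL := Γ.len_pos e
  have hx := coord_mem_Ico e x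
  rw [Γ.integral_edgeLength e (Γ.continuous_green x), intervalIntegral.integral_congr
    (fun t ht => Γ.green_param x e (by rwa [uIcc_of_le hL.le] at ht)),
    intervalIntegral.integral_add, integral_segmentGreen ⟨hx.1, hx.2.le⟩ hL.ne',
    intervalIntegral.integral_add, intervalIntegral.integral_const_mul, integral_id]
  · simp
    field_simp
    ring
  all_goals
    refine Continuous.intervalIntegrable ?_ _ _
    first | fun_prop | (unfold segmentGreen; fun_prop)

/-- For a vertex `x` this is `sum_vertexGreen`; both sides are affine in `x` along each edge. -/
theorem sum_green_vertex_mul (x : Γ.Point) (φ : V → ℝ) :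
    ∑ e, (Γ.green x (.vertex (Γ.head e)) - Γ.green x (.vertex (Γ.tail e))) / Γ.len e *
      (φ (Γ.head e) - φ (Γ.tail e)) = Γ.interp φ x - (∑ v, φ v) / Fintype.card V := by
  have hv (v : V) (x : Γ.Point) :
      Γ.green x (.vertex v) = Γ.interp (fun u => Γ.vertexGreen v u) x := by
    simp only [Γ.vertexGreen_comm v]
    exact congrFun (Γ.green_vertex v) x
  simp only [hv]
  cases x with
  | vertex u => exact Γ.sum_vertexGreen φ u
  | inner e s =>
    have h1 := Γ.sum_vertexGreen φ (Γ.tail e)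
    have h2 := Γ.sum_vertexGreen φ (Γ.head e)
    have h3 : Γ.interp φ (.inner e s) - (∑ v, φ v) / Fintype.card V =
        (1 - s / Γ.len e) * (φ (Γ.tail e) - (∑ v, φ v) / Fintype.card V) +
          s / Γ.len e * (φ (Γ.head e) - (∑ v, φ v) / Fintype.card V) := by
      simp only [interp]
      ring
    rw [h3, ← h1, ← h2, Finset.mul_sum, Finset.mul_sum, ← Finset.sum_add_distrib]
    refine Finset.sum_congr rfl fun e' _ => ?_
    simp only [interp]
    ring

variable {Γ} in
theorem IsQuadratic.laplacian_univ {f : Γ.Point → ℝ} {a b c : E → ℝ}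
    (hf : Γ.IsQuadratic f a b c) : Γ.laplacian f univ = 0 := by
  rw [hf.laplacian_eq, _root_.sum_apply]
  refine Finset.sum_eq_zero fun e _ => ?_
  have h : (Γ.edgeLength e).real univ = Γ.len e := by
    rw [measureReal_def, edgeLength, Measure.map_apply (Γ.measurable_param e) MeasurableSet.univ]
    simp [(Γ.len_pos e).le]
  simp [dirac, Measure.toSignedMeasure_apply_measurable MeasurableSet.univ, h]

omit [Fintype V] in
variable {Γ} in
theorem IsQuadratic.eq_interp_sub {f : Γ.Point → ℝ} {a b c : E → ℝ}
    (hf : Γ.IsQuadratic f a b c) (x : Γ.Point) :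
    f x = Γ.interp (fun v => f (.vertex v)) x -
      ∑ e, c e * (Γ.coord e x * (Γ.len e - Γ.coord e x)) := by
  cases x with
  | vertex v => simp [coord, interp]
  | inner e s =>
    have hL := (Γ.len_pos e).ne'
    have h1 := hf e 0 ⟨le_rfl, (Γ.len_pos e).le⟩
    have h2 := hf e _ ⟨(Γ.len_pos e).le, le_rfl⟩
    have h3 := hf e s ⟨s.2.1.le, s.2.2.le⟩
    rw [param_zero] at h1
    rw [param_len] at h2
    rw [param_coe] at h3
    rw [Finset.sum_eq_single e (fun e' _ he => by simp [coord, he.symm]) (by simp)]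
    simp only [interp, h1, h2, h3, coord, if_true]
    field_simp
    ring

variable {Γ} in
-- Green's identity, checked edge by edge: the curvature of `f` produces its deviation from the
-- chord (`IsQuadratic.eq_interp_sub`), and the chord slopes pair with g as in
-- `sum_green_vertex_mul`.
theorem IsQuadratic.integral_green_laplacian {f : Γ.Point → ℝ} {a b c : E → ℝ}
    (hf : Γ.IsQuadratic f a b c) (x : Γ.Point) :
    VectorMeasure.integral (Γ.laplacian f) (Γ.green x) (ContinuousLinearMap.lsmul ℝ ℝ).flip =
      f x - (∑ v, f (.vertex v)) / Fintype.card V := by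
  have hi (μ : SignedMeasure Γ.Point) : VectorMeasure.Integrable μ (Γ.green x) :=
    Γ.integrable_of_continuous μ (Γ.continuous_green x)
  rw [hf.laplacian_eq, VectorMeasure.integral_finsetSum_vectorMeasure fun _ _ => hi _]
  have h (e : E) : VectorMeasure.integral ((-(2 * c e)) • (Γ.edgeLength e).toSignedMeasure
      + (-b e) • Γ.dirac (.vertex (Γ.tail e))
      + (b e + 2 * c e * Γ.len e) • Γ.dirac (.vertex (Γ.head e))) (Γ.green x)
        (ContinuousLinearMap.lsmul ℝ ℝ).flip =
      (Γ.green x (.vertex (Γ.head e)) - Γ.green x (.vertex (Γ.tail e))) / Γ.len e *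
      (f (.vertex (Γ.head e)) - f (.vertex (Γ.tail e))) -
        c e * (Γ.coord e x * (Γ.len e - Γ.coord e x)) := by
    have hL := (Γ.len_pos e).ne'
    rw [VectorMeasure.integral_add_vectorMeasure (hi _) (hi _),
      VectorMeasure.integral_add_vectorMeasure (hi _) (hi _),
      VectorMeasure.integral_smul_vectorMeasure, VectorMeasure.integral_smul_vectorMeasure,
      VectorMeasure.integral_smul_vectorMeasure, VectorMeasure.integral_toSignedMeasure,
      integral_green_edgeLength, dirac, dirac, VectorMeasure.integral_dirac,
      VectorMeasure.integral_dirac]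
    have h1 := hf e 0 ⟨le_rfl, (Γ.len_pos e).le⟩
    have h2 := hf e _ ⟨(Γ.len_pos e).le, le_rfl⟩
    rw [param_zero] at h1
    rw [param_len] at h2
    simp only [h1, h2, ContinuousLinearMap.flip_apply, ContinuousLinearMap.lsmul_apply, smul_eq_mul]
    field_simp
    ring
  rw [Finset.sum_congr rfl fun e _ => h e, Finset.sum_sub_distrib,
    Γ.sum_green_vertex_mul x fun v => f (.vertex v), hf.eq_interp_sub x]
  ring

theorem voltageIntegral_self (μ : SignedMeasure Γ.Point) (x : Γ.Point) :
    Γ.voltageIntegral μ x x = Γ.green x x * μ univ -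
      2 * VectorMeasure.integral μ (Γ.green x) (ContinuousLinearMap.lsmul ℝ ℝ).flip +
      VectorMeasure.integral μ (fun y => Γ.green y y) (ContinuousLinearMap.lsmul ℝ ℝ).flip := by
  have hi {f : Γ.Point → ℝ} (hf : Continuous f) : VectorMeasure.Integrable μ f :=
    Γ.integrable_of_continuous μ hf
  have h (y : Γ.Point) : Γ.voltage y x x =
      Γ.green x x - (2 : ℝ) • Γ.green x y + Γ.green y y := by
    rw [voltage_eq, Γ.green_comm y x, smul_eq_mul]
    ring
  have hc := Γ.continuous_green x
  have hd := Γ.memZh_green_diag.1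
  simp only [voltageIntegral, h]
  rw [VectorMeasure.integral_fun_add (hi (by fun_prop)) (hi hd),
    VectorMeasure.integral_fun_sub (hi continuous_const) (hi (by fun_prop)),
    VectorMeasure.integral_fun_smul, VectorMeasure.integral_const]
  simp [mul_comm]

/-- The explicit formula for the canonical measure in terms of the Green function. -/
noncomputable def greenMeasure : SignedMeasure Γ.Point :=
  (1 / 2 : ℝ) • Γ.laplacian (fun x => Γ.green x x) + Γ.uniformVertex

theorem two_smul_greenMeasure (p q : Γ.Point) : (2 : ℝ) • Γ.greenMeasure =
    Γ.laplacian (fun x => Γ.voltage x p q) + Γ.dirac q + Γ.dirac p := by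
  rw [laplacian_voltage, greenMeasure]
  ext s hs
  simp

theorem isCanonical_greenMeasure : Γ.IsCanonical Γ.greenMeasure := by
  have : Nonempty V := Γ.nonempty
  have hn : (Fintype.card V : ℝ) ≠ 0 := by simp
  have huniv : Γ.greenMeasure univ = 1 := by
    rw [greenMeasure, _root_.add_apply, _root_.smul_apply, Γ.isQuadratic_green_diag.laplacian_univ]
    simp [uniformVertex, dirac, hn]
  -- Constancy of the row sums of M extends from vertices to all points by `green_inner`, since
  -- tents vanish at vertices.
  have hsum (x : Γ.Point) : ∑ v, Γ.green x (.vertex v) =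
      ∑ v, Γ.vertexGreen this.some v := by
    have h1 (u : V) : ∑ v, Γ.green (.vertex u) (.vertex v) = ∑ v, Γ.vertexGreen this.some v := by
      rw [← Γ.sum_vertexGreen_eq u]
      refine Finset.sum_congr rfl fun v _ => ?_
      exact congrFun (Γ.green_vertex v) (.vertex u)
    cases x with
    | vertex u => exact h1 u
    | inner e s =>
      have h2 (v : V) := congrFun (Γ.green_inner e s) (.vertex v)
      have h3 (v : V) : Γ.tent e s (.vertex v) = 0 := segmentGreen_zero_left _ s.2.1.le
      have h4 (v : V) : Γ.green (.inner e s) (.vertex v) =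
          (1 - s / Γ.len e) * Γ.green (.vertex (Γ.tail e)) (.vertex v) +
            s / Γ.len e * Γ.green (.vertex (Γ.head e)) (.vertex v) := by
        rw [green_comm, h2 v, Γ.green_comm _ (.vertex v), Γ.green_comm _ (.vertex v)]
        simp [h3]
      simp only [h4, Finset.sum_add_distrib, ← Finset.mul_sum, h1]
      ring
  have hi (μ : SignedMeasure Γ.Point) (x : Γ.Point) : VectorMeasure.Integrable μ (Γ.green x) :=
    Γ.integrable_of_continuous μ (Γ.continuous_green x)
  have hint (x : Γ.Point) : VectorMeasure.integral Γ.uniformVertex (Γ.green x)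
      (ContinuousLinearMap.lsmul ℝ ℝ).flip =
        (∑ v, Γ.vertexGreen this.some v) / Fintype.card V := by
    rw [uniformVertex, VectorMeasure.integral_smul_vectorMeasure,
      VectorMeasure.integral_finsetSum_vectorMeasure fun _ _ => hi _ _, ← hsum x]
    simp [dirac, div_eq_inv_mul]
  -- The constant is left open and is fixed by the last equality, where the diagonal term `d` has
  -- cancelled.
  refine ⟨huniv, ?_, fun x => ?_⟩
  rotate_left
  · rw [voltageIntegral_self, huniv, greenMeasure,
      VectorMeasure.integral_add_vectorMeasure (hi _ _) (hi _ _),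
      VectorMeasure.integral_smul_vectorMeasure,
      Γ.isQuadratic_green_diag.integral_green_laplacian, hint, smul_eq_mul, ← greenMeasure]
    have h (d m r i : ℝ) : d * 1 - 2 * (1 / 2 * (d - m) + r) + i = m - 2 * r + i := by ring
    exact h _ _ _ _

end Integral
-- Uniqueness of the canonical measure.
section Uniqueness

variable {V E : Type*} (Γ : MetrizedGraph V E)

/-- `coord` jumps at the head of the edge, so continuity is not available; its superlevel sets are
nevertheless open. -/
theorem measurable_coord (e : E) : Measurable (Γ.coord e) := by
  refine measurable_of_Ioi fun s => ?_
  rcases lt_or_ge s 0 with hs | hs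
  · convert MeasurableSet.univ
    exact eq_univ_of_forall fun p => hs.trans_le (coord_mem_Ico e p).1
  · convert (Γ.isOpen_param_image e (Ioi s) isOpen_Ioi).measurableSet
    ext p
    simp only [mem_preimage, mem_Ioi, mem_image]
    constructor
    · cases p with
      | vertex v => exact fun h => absurd h hs.not_gt
      | inner e' t =>
        by_cases he : e' = e
        · subst he
          simp only [coord, if_true]
          exact fun h => ⟨t, ⟨t.2, h⟩, Γ.param_coe t⟩
        · simp only [coord, he, if_false]
          exact fun h => absurd h hs.not_gt
    · rintro ⟨t, ⟨ht, hst⟩, rfl⟩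
      simpa [Γ.param_of_mem ht, coord] using hst

variable [Fintype V] [Fintype E]

variable {Γ} {σ : SignedMeasure Γ.Point}

omit [Fintype V] [Fintype E] in
theorem integrable_of_measurable_of_bound {f : Γ.Point → ℝ} (hf : Measurable f) {C : ℝ}
    (h : ∀ p, |f p| ≤ C) : VectorMeasure.Integrable σ f :=
  Integrable.of_bound hf.aestronglyMeasurable C (Eventually.of_forall h)

/-- The right derivative in `s` of min(t,s) - ts/L is 1_{t>s} - t/L. Integrals of tents being zero,
dominated convergence shows that this derivative also integrates to zero. The right side does not
depend on `s`, which is the point. -/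
theorem apply_coord_gt_eq (e : E)
    (h : ∀ s ∈ Ioo 0 (Γ.len e), VectorMeasure.integral σ (Γ.tent e s)
      (ContinuousLinearMap.lsmul ℝ ℝ).flip = 0) {s : ℝ} (hs : s ∈ Ico 0 (Γ.len e)) :
    σ (Γ.coord e ⁻¹' Ioi s) = VectorMeasure.integral σ (fun p => Γ.coord e p / Γ.len e)
      (ContinuousLinearMap.lsmul ℝ ℝ).flip := by
  have hL := Γ.len_pos e
  have hS : MeasurableSet (Γ.coord e ⁻¹' Ioi s) := Γ.measurable_coord e measurableSet_Ioi
  have h' : ∀ s ∈ Ico 0 (Γ.len e), VectorMeasure.integral σ (Γ.tent e s)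
      (ContinuousLinearMap.lsmul ℝ ℝ).flip = 0 := fun s hs => by
    rcases eq_or_lt_of_le hs.1 with rfl | h0
    · rw [tent_zero]
      exact VectorMeasure.integral_zero
    · exact h s ⟨h0, hs.2⟩
  have hnear : ∀ᶠ r in 𝓝[>] (0 : ℝ), 0 < r ∧ s + r ∈ Ico 0 (Γ.len e) := by
    filter_upwards [Ioo_mem_nhdsGT (sub_pos.2 hs.2)] with r hr
    exact ⟨hr.1, by linarith [hs.1, hr.1], by linarith [hr.2]⟩
  have hlim : Tendsto (fun r : ℝ => VectorMeasure.integral σ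
      (fun p => r⁻¹ • (Γ.tent e (s + r) p - Γ.tent e s p)) (ContinuousLinearMap.lsmul ℝ ℝ).flip)
      (𝓝[>] 0) (𝓝 (VectorMeasure.integral σ (fun p => (Γ.coord e ⁻¹' Ioi s).indicator
        (fun _ => 1) p - Γ.coord e p / Γ.len e) (ContinuousLinearMap.lsmul ℝ ℝ).flip)) := by
    refine VectorMeasure.tendsto_integral_filter_of_dominated_convergence (fun _ => 1) ?_ ?_
      (integrable_const _) ?_
    · filter_upwards [hnear] with r hr
      have h1 := continuous_tent e hr.2
      have h2 := continuous_tent e hs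
      exact Continuous.aestronglyMeasurable (by fun_prop)
    -- The increment of the minimum and `coord * r / len` both lie in [0, r], so the quotient is
    -- bounded by 1.
    · filter_upwards [hnear] with r hr
      refine Eventually.of_forall fun p => ?_
      have hp := coord_mem_Ico e p
      have h1 : 0 ≤ min (Γ.coord e p) (s + r) - min (Γ.coord e p) s :=
        sub_nonneg.2 (min_le_min_left _ (by linarith))
      have h2 : min (Γ.coord e p) (s + r) - min (Γ.coord e p) s ≤ r := by
        rcases min_cases (Γ.coord e p) s with h | h <;> rw [h.1]
        · linarith [min_le_left (Γ.coord e p) (s + r)]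
        · linarith [min_le_right (Γ.coord e p) (s + r)]
      have h3 : 0 ≤ Γ.coord e p * r / Γ.len e := by
        have := hp.1
        have := hr.1
        positivity
      have h4 : Γ.coord e p * r / Γ.len e ≤ r := by
        rw [div_le_iff₀ hL, mul_comm]
        exact mul_le_mul_of_nonneg_left hp.2.le hr.1.le
      have h5 : Γ.tent e (s + r) p - Γ.tent e s p = min (Γ.coord e p) (s + r) -
          min (Γ.coord e p) s - Γ.coord e p * r / Γ.len e := by
        simp only [tent, segmentGreen]
        ring
      rw [norm_smul, norm_inv, Real.norm_eq_abs, Real.norm_eq_abs, abs_of_pos hr.1, h5,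
        inv_mul_le_iff₀ hr.1, abs_le]
      constructor <;> linarith
    · refine Eventually.of_forall fun p => tendsto_const_nhds.congr' ?_
      by_cases hp : s < Γ.coord e p
      · filter_upwards [Ioo_mem_nhdsGT (sub_pos.2 hp)] with r hr
        have hr0 := hr.1.ne'
        simp only [tent, segmentGreen, mem_preimage, mem_Ioi, hp, indicator_of_mem, smul_eq_mul]
        rw [min_eq_right hp.le, min_eq_right (by linarith [hr.2])]
        field_simp
        ring
      · filter_upwards [self_mem_nhdsWithin] with r hr
        have hr0 : r ≠ 0 := (mem_Ioi.1 hr).ne'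
        simp only [tent, segmentGreen, mem_preimage, mem_Ioi, hp, not_false_eq_true,
          indicator_of_notMem, smul_eq_mul]
        rw [min_eq_left (not_lt.1 hp), min_eq_left (by linarith [not_lt.1 hp, mem_Ioi.1 hr])]
        field_simp
        ring
  have hzero : (fun r : ℝ => VectorMeasure.integral σ
      (fun p => r⁻¹ • (Γ.tent e (s + r) p - Γ.tent e s p))
      (ContinuousLinearMap.lsmul ℝ ℝ).flip) =ᶠ[𝓝[>] (0 : ℝ)] fun _ => 0 := by
    filter_upwards [hnear] with r hr
    rw [VectorMeasure.integral_fun_smul, VectorMeasure.integral_fun_sub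
      (Γ.integrable_of_continuous σ (continuous_tent e hr.2))
      (Γ.integrable_of_continuous σ (continuous_tent e hs)), h' _ hr.2, h' _ hs]
    simp
  have h0 := tendsto_nhds_unique hlim (tendsto_const_nhds.congr' hzero.symm)
  have hi1 : VectorMeasure.Integrable σ ((Γ.coord e ⁻¹' Ioi s).indicator fun _ => (1 : ℝ)) :=
    (integrable_const _).indicator hS
  have hi2 : VectorMeasure.Integrable σ (fun p => Γ.coord e p / Γ.len e) := by
    refine integrable_of_measurable_of_bound ((Γ.measurable_coord e).div_const _) (C := 1)
      fun p => ?_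
    have := coord_mem_Ico e p
    rw [abs_of_nonneg (div_nonneg this.1 hL.le), div_le_one hL]
    exact this.2.le
  rw [VectorMeasure.integral_fun_sub hi1 hi2, VectorMeasure.integral_indicator hS,
    VectorMeasure.integral_const, sub_eq_zero] at h0
  rw [← h0]
  simp [VectorMeasure.restrict_apply, hS]

theorem apply_coord_preimage_eq_zero (e : E)
    (h : ∀ s ∈ Ioo 0 (Γ.len e), VectorMeasure.integral σ (Γ.tent e s)
      (ContinuousLinearMap.lsmul ℝ ℝ).flip = 0) (hσ : σ univ = 0) {B : Set ℝ}
    (hB : MeasurableSet B) : σ (Γ.coord e ⁻¹' B) = 0 := by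
  have hL := Γ.len_pos e
  have hm := Γ.measurable_coord e
  set k := VectorMeasure.integral σ (fun p => Γ.coord e p / Γ.len e)
    (ContinuousLinearMap.lsmul ℝ ℝ).flip
  -- The sets where the coordinate exceeds `u n` all have mass `k` and decrease to the empty set,
  -- because coordinates stay below the edge length.
  have hk : k = 0 := by
    obtain ⟨u, hu, huL, hlim⟩ := exists_seq_strictMono_tendsto' hL
    have ht := VectorMeasure.tendsto_vectorMeasure_iInter_atTop_nat (v := σ)
      (s := fun n => Γ.coord e ⁻¹' Ioi (u n))
      (fun m n hmn => preimage_mono (Ioi_subset_Ioi (hu.monotone hmn)))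
      fun n => hm measurableSet_Ioi
    have hempty : ⋂ n, Γ.coord e ⁻¹' Ioi (u n) = ∅ := by
      refine eq_empty_of_forall_notMem fun p hp => ?_
      obtain ⟨n, hn⟩ := (hlim.eventually (lt_mem_nhds (coord_mem_Ico e p).2)).exists
      exact lt_asymm hn (mem_iInter.1 hp n)
    rw [hempty, VectorMeasure.empty] at ht
    refine tendsto_nhds_unique (tendsto_const_nhds.congr fun n => ?_) ht
    exact (apply_coord_gt_eq e h ⟨(huL n).1.le, (huL n).2⟩).symm
  have hmap : σ.map (Γ.coord e) = 0 := by
    -- For `s < 0` the half-line pulls back to the whole space, of mass 0; for `s` at least the edge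
    -- length it pulls back to the empty set.
    refine VectorMeasure.ext_of_generateFrom (range Ioi) ?_
      ((BorelSpace.measurable_eq (α := ℝ)).trans (borel_eq_generateFrom_Ioi ℝ)) isPiSystem_Ioi ?_
    · rintro _ ⟨s, rfl⟩
      rw [VectorMeasure.map_apply _ hm measurableSet_Ioi, _root_.zero_apply]
      rcases lt_or_ge s 0 with hs | hs
      · rw [← hσ]
        congr 1
        exact eq_univ_of_forall fun p => hs.trans_le (coord_mem_Ico e p).1
      rcases lt_or_ge s (Γ.len e) with hs' | hs'
      · rw [apply_coord_gt_eq e h ⟨hs, hs'⟩]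
        exact hk
      · rw [← σ.empty]
        congr 1
        exact eq_empty_of_forall_notMem fun p hp =>
          lt_asymm ((coord_mem_Ico e p).2.trans_le hs') hp
    · rw [VectorMeasure.map_apply _ hm MeasurableSet.univ, preimage_univ, hσ, _root_.zero_apply]
  rw [← VectorMeasure.map_apply _ hm hB, hmap, _root_.zero_apply]

theorem apply_eq_sum_vertex (h : ∀ e, ∀ s ∈ Ioo 0 (Γ.len e), VectorMeasure.integral σ (Γ.tent e s)
      (ContinuousLinearMap.lsmul ℝ ℝ).flip = 0) (hσ : σ univ = 0) :
    σ = ∑ v, σ {.vertex v} • Γ.dirac (.vertex v) := by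
  classical
  ext A hA
  let P : V ⊕ E → Set Γ.Point := Sum.elim (fun v => {.vertex v}) fun e => range (.inner e)
  have hP : ∀ i, MeasurableSet (P i) := by
    rintro (v | e)
    · exact measurableSet_singleton _
    · exact Γ.measurableSet_range_inner e
  have hdisj : Pairwise (Function.onFun Disjoint P) := by
    rintro (v | e) (v' | e') hne <;> simp only [Function.onFun, P, Sum.elim_inl, Sum.elim_inr] <;>
      rw [Set.disjoint_left]
    · rintro p rfl hp
      injection hp with h
      exact hne (h ▸ rfl)
    · rintro p rfl ⟨t, ht⟩
      cases ht
    · rintro p ⟨t, rfl⟩ hp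
      cases hp
    · rintro p ⟨t, rfl⟩ ⟨t', ht'⟩
      injection ht' with h
      exact hne (h ▸ rfl)
  have hunion : A = ⋃ i, A ∩ P i := by
    rw [← inter_iUnion, inter_eq_left.2]
    intro p _
    cases p with
    | vertex v => exact mem_iUnion.2 ⟨.inl v, rfl⟩
    | inner e t => exact mem_iUnion.2 ⟨.inr e, t, rfl⟩
  -- Intersecting with the open interval removes coordinate 0, where `coord` sends everything
  -- outside the edge.
  have hE (e : E) : σ (A ∩ P (.inr e)) = 0 := by
    rw [← apply_coord_preimage_eq_zero e (h e) hσ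
      (measurableSet_Ioo.inter (Γ.measurable_param e hA) : MeasurableSet (Ioo 0 (Γ.len e) ∩ _))]
    congr 1
    ext p
    cases p with
    | vertex v => simp [P, coord]
    | inner e' t =>
      by_cases he : e' = e
      · subst he
        have := t.2
        simp only [mem_inter_iff, mem_preimage, coord, if_true, Γ.param_coe, P, Sum.elim_inr,
          mem_range_self, and_true, this, true_and]
      · have : ∀ s, Point.inner e s ≠ (Point.inner e' t : Γ.Point) := fun s hs => by
          injection hs with h
          exact he h.symm
        simp [P, coord, he, this]
  have hV (v : V) : σ (A ∩ P (.inl v)) = σ {.vertex v} * Γ.dirac (.vertex v) A := by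
    by_cases hv : Point.vertex v ∈ A
    · rw [dirac, VectorMeasure.dirac_apply_of_mem hA hv, mul_one]
      exact congrArg σ (inter_eq_right.2 (singleton_subset_iff.2 hv))
    · rw [dirac, VectorMeasure.dirac_apply_of_notMem hv, mul_zero]
      exact (congrArg σ (inter_singleton_eq_empty.2 hv)).trans σ.empty
  conv_lhs => rw [hunion]
  rw [VectorMeasure.of_disjoint_iUnion (fun i => hA.inter (hP i))
    fun i j hij => (hdisj hij).mono inter_subset_right inter_subset_right, tsum_fintype,
    Fintype.sum_sum_type]
  simp [hE, hV, _root_.sum_apply]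

theorem eq_zero_of_integral_green_eq (hσ : σ univ = 0) {C : ℝ}
    (hC : ∀ x, VectorMeasure.integral σ (Γ.green x) (ContinuousLinearMap.lsmul ℝ ℝ).flip = C) :
    σ = 0 := by
  classical
  have hi (x : Γ.Point) : VectorMeasure.Integrable σ (Γ.green x) :=
    Γ.integrable_of_continuous σ (Γ.continuous_green x)
  have htent : ∀ e, ∀ s ∈ Ioo 0 (Γ.len e), VectorMeasure.integral σ (Γ.tent e s)
      (ContinuousLinearMap.lsmul ℝ ℝ).flip = 0 := fun e s hs => by
    -- The coefficients of the three Green functions add up to zero, so the constant `C` cancels.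
    have h : Γ.tent e s = fun y => Γ.green (.inner e ⟨s, hs⟩) y -
        ((1 - s / Γ.len e) • Γ.green (.vertex (Γ.tail e)) y +
          (s / Γ.len e) • Γ.green (.vertex (Γ.head e)) y) := by
      funext y
      have := congrFun (Γ.green_inner e ⟨s, hs⟩) y
      rw [green_comm, this]
      simp [Γ.green_comm y]
    have hi' (c : ℝ) (x : Γ.Point) : VectorMeasure.Integrable σ (fun y => c • Γ.green x y) :=
      (hi x).smul c
    have hi'' (c d : ℝ) (x y : Γ.Point) :
        VectorMeasure.Integrable σ (fun z => c • Γ.green x z + d • Γ.green y z) :=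
      (hi' c x).add (hi' d y)
    rw [h, VectorMeasure.integral_fun_sub (hi _) (hi'' _ _ _ _),
      VectorMeasure.integral_fun_add (hi' _ _) (hi' _ _),
      VectorMeasure.integral_fun_smul, VectorMeasure.integral_fun_smul, hC, hC, hC]
    simp
    ring
  have hsum := apply_eq_sum_vertex htent hσ
  set a : V → ℝ := fun v => σ {.vertex v}
  have ha : ∑ v, a v = 0 := by
    rw [← hσ, hsum]
    simp [dirac, a]
  have hMa (u : V) : ∑ v, Γ.vertexGreen u v * a v = C := by
    rw [← hC (.vertex u), hsum, VectorMeasure.integral_finsetSum_vectorMeasure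
      fun _ _ => Γ.integrable_of_continuous _ (Γ.continuous_green _)]
    refine Finset.sum_congr rfl fun v _ => ?_
    rw [VectorMeasure.integral_smul_vectorMeasure, dirac, VectorMeasure.integral_dirac,
      congrFun (Γ.green_vertex v) (.vertex u)]
    simp [interp, mul_comm, a]
  -- The weak identity for the indicator of `v`, weighted by `a` and summed, returns `a v` because
  -- `a` has sum 0; the other side contains only differences of entries of Ma, which is constant.
  have hzero (v : V) : a v = 0 := by
    have h (u : V) := Γ.sum_vertexGreen (Pi.single v 1) u
    have h1 : ∑ u, (∑ e, (Γ.vertexGreen (Γ.head e) u - Γ.vertexGreen (Γ.tail e) u) / Γ.len e *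
      ((Pi.single v 1 : V → ℝ) (Γ.head e) - (Pi.single v 1 : V → ℝ) (Γ.tail e))) * a u = a v := by
      simp only [h, sub_mul, Finset.sum_sub_distrib, ← Finset.mul_sum, ha]
      simp [Pi.single_apply]
    rw [← h1]
    simp only [Finset.sum_mul]
    rw [Finset.sum_comm]
    refine Finset.sum_eq_zero fun e _ => ?_
    have h2 : ∑ u, (Γ.vertexGreen (Γ.head e) u * a u - Γ.vertexGreen (Γ.tail e) u * a u) = 0 := by
      rw [Finset.sum_sub_distrib, hMa, hMa, sub_self]
    rw [← mul_zero (((Pi.single v 1 : V → ℝ) (Γ.head e) - (Pi.single v 1 : V → ℝ) (Γ.tail e)) /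
      Γ.len e), ← h2, Finset.mul_sum]
    exact Finset.sum_congr rfl fun u _ => by ring
  rw [hsum]
  exact Finset.sum_eq_zero fun v _ => by rw [show σ {.vertex v} = 0 from hzero v, zero_smul]

theorem IsCanonical.eq {μ ν : SignedMeasure Γ.Point} (hμ : Γ.IsCanonical μ)
    (hν : Γ.IsCanonical ν) : μ = ν := by
  obtain ⟨hμ1, c, hc⟩ := hμ
  obtain ⟨hν1, d, hd⟩ := hν
  have hi (μ : SignedMeasure Γ.Point) (x : Γ.Point) : VectorMeasure.Integrable μ (Γ.green x) :=
    Γ.integrable_of_continuous μ (Γ.continuous_green x)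
  rw [← sub_eq_zero]
  simp only [voltageIntegral_self, hμ1, hν1] at hc hd
  refine eq_zero_of_integral_green_eq (C := (VectorMeasure.integral μ (fun y => Γ.green y y)
    (ContinuousLinearMap.lsmul ℝ ℝ).flip - VectorMeasure.integral ν (fun y => Γ.green y y)
    (ContinuousLinearMap.lsmul ℝ ℝ).flip - c + d) / 2) ?_ fun x => ?_
  · rw [_root_.sub_apply, hμ1, hν1, sub_self]
  · rw [VectorMeasure.integral_sub_vectorMeasure (hi _ _) (hi _ _)]
    linarith [hc x, hd x]

end Uniqueness
end MetrizedGraph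

/-! ### Conclusion. -/

theorem mainTheorem9 {V E : Type*} [Fintype V] [Fintype E] (Γ : MetrizedGraph V E) :
    (∃! μ : SignedMeasure Γ.Point, Γ.IsCanonical μ) ∧
      ∀ p q : Γ.Point,
        Γ.MemZh (fun x => Γ.voltage x p q) ∧
        (2 : ℝ) • Γ.canonicalMeasure =
          Γ.laplacian (fun x => Γ.voltage x p q) + Γ.dirac q + Γ.dirac p := by
  have h := Γ.isCanonical_greenMeasure
  refine ⟨⟨_, h, fun μ hμ => hμ.eq h⟩, fun p q => ⟨Γ.memZh_voltage p q, ?_⟩⟩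
  have hcan : Γ.canonicalMeasure = Γ.greenMeasure :=
    (Classical.epsilon_spec ⟨_, h⟩ : Γ.IsCanonical (Classical.epsilon Γ.IsCanonical)).eq h
  rw [hcan, Γ.two_smul_greenMeasure p q]
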